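/- Let $\mathbb{D}=\{z\in\mathbb{C}:|z|<1\}$. For functions $g,f$ on $\mathbb D$ write $g\prec f$ if $g=f\circ w$ on $\mathbb{D}$ for some analytic $w:\mathbb{D}\to\mathbb{D}$ with $w(0)=0$. Let $\psi$ be analytic and univalent in $\mathbb{D}$ with $\Re\psi>0$, $\psi(0)=1$, $\psi'(0)>0$ and $\psi(\mathbb{D})$ symmetric about the real axis. Let $\mathcal{S}^*(\psi)$ be the class of analytic functions $f(z)=z+\sum_{k\ge2}a_kz^k$ in $\mathbb{D}$ with $zf'(z)/f(z)\prec\psi(z)$ (the quotient being analytic in $\mathbb D$, with value $1$ at $0$). Let $r_*$ be the Koebe radius of $\mathcal{S}^*(\psi)$, that is, the largest $\rho$ such that $\{|z|<\rho\}\subset f(\mathbb{D})$ for all $f\in\mathcal{S}^*(\psi)$. Put $$f_0(z)=z\exp\int_0^z\frac{\psi(t)-1}{t}\,dt=z+\sum_{n\ge2}t_nz^n,\qquad \hat f_0(r)=r+\sum_{n\ge2}|t_n|r^n .$$ Then the equation $\hat f_0(r)=r_*$ has a least positive root $r_0$, and with $r_b=\min\{r_0,1/3\}$ the following holds. For every $f\in\mathcal{S}^*(\psi)$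 and every $g(z)=\sum_{k\ge1}b_kz^k$ with $g\prec f$, $$\sum_{k=1}^{\infty}|b_k|r^k\le d\bigl(f(0),\partial f(\mathbb{D})\bigr)\qquad\text{for all } 0\le r\le r_b ,$$ where $d$ denotes the Euclidean distance. If $r_b=r_0$ and $t_n>0$ for all $n\ge2$, the result is sharp, with extremal function $f_0$: one has $f_0\in\mathcal{S}^*(\psi)$, and for $f=g=f_0$ equality holds at $r=r_0$ while the inequality fails for every $r_0<r<1$; in particular $r_b$ cannot be replaced by any larger number. -/

import Mathlib

open Complex Set Metric

noncomputable section

namespace MaMinda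

/-- The open unit disk. -/
def disk : Set ℂ := ball (0 : ℂ) 1

/-- The `n`-th Taylor coefficient of `f` at the origin. -/
def taylorCoeff (f : ℂ → ℂ) (n : ℕ) : ℂ := iteratedDeriv n f 0 / (n.factorial : ℂ)

/-- `g ≺ f` on the unit disk: `g = f ∘ w` for some Schwarz function `w`. -/
def Subordinate (g f : ℂ → ℂ) : Prop :=
  ∃ w : ℂ → ℂ, DifferentiableOn ℂ w disk ∧ MapsTo w disk disk ∧ w 0 = 0 ∧
    ∀ z ∈ disk, g z = f (w z)

/-- Ma-Minda functions: analytic and univalent in the disk, with positive real part, normalized by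
`ψ 0 = 1` and `ψ' 0 > 0`, with image symmetric about the real axis. -/
structure IsMaMinda (ψ : ℂ → ℂ) : Prop where
  analytic : DifferentiableOn ℂ ψ disk
  univalent : InjOn ψ disk
  re_pos : ∀ z ∈ disk, 0 < (ψ z).re
  map_zero : ψ 0 = 1
  deriv_re_pos : 0 < (deriv ψ 0).re
  deriv_im : (deriv ψ 0).im = 0
  symm : ∀ u ∈ ψ '' disk, (starRingEnd ℂ) u ∈ ψ '' disk

/-- Analytic functions in the disk of the form `z + a₂ z² + ⋯`. -/
structure IsNormalized (f : ℂ → ℂ) : Prop where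
  analytic : DifferentiableOn ℂ f disk
  map_zero : f 0 = 0
  deriv_zero : deriv f 0 = 1

/-- The function `z f'(z) / f(z)`, with its removable singularity at `0` filled by the value `1`. -/
def starQuotient (f : ℂ → ℂ) : ℂ → ℂ :=
  Function.update (fun z => z * deriv f z / f z) 0 1

/-- The class `S*(ψ)`. The quotient `z f'(z) / f(z)` has to be defined (and analytic) in the whole
disk, so `f` has no zero there other than the origin. -/
def starClass (ψ : ℂ → ℂ) : Set (ℂ → ℂ) :=
  {f | IsNormalized f ∧ (∀ z ∈ disk, z ≠ 0 → f z ≠ 0) ∧ Subordinate (starQuotient f) ψ}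

/-- `f₀(z) = z exp ∫₀ᶻ (ψ(t) - 1) / t dt`, the integral being taken along the segment `t = s z`,
`0 ≤ s ≤ 1`. -/
def extremal (ψ : ℂ → ℂ) (z : ℂ) : ℂ :=
  z * Complex.exp (∫ s in (0 : ℝ)..1, (ψ ((s : ℂ) * z) - 1) / ((s : ℂ) * z) * z)

/-- The Koebe radius of `S*(ψ)`: the radius of the largest disk about the origin that is contained
in `f(𝔻)` for every `f` in the class. -/
def koebeRadius (ψ : ℂ → ℂ) : ℝ :=
  sSup {ρ : ℝ | ∀ f ∈ starClass ψ, ball (0 : ℂ) ρ ⊆ f '' disk}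

/-- The Euclidean distance from `f(0)` to the boundary of `f(𝔻)`. -/
def boundaryDist (f : ℂ → ℂ) : ℝ := infDist (f 0) (frontier (f '' disk))

/-- The Bohr inequality `∑_{k ≥ 1} |b_k| r^k ≤ d(f(0), ∂f(𝔻))` for every `g = ∑ b_k z^k ≺ f` and
every `0 ≤ r ≤ R`. -/
def BohrPhenomenon (f : ℂ → ℂ) (R : ℝ) : Prop :=
  ∀ g : ℂ → ℂ, Subordinate g f → ∀ r : ℝ, 0 ≤ r → r ≤ R →
    Summable (fun k : ℕ => ‖taylorCoeff g (k + 1)‖ * r ^ (k + 1)) ∧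
      ∑' k : ℕ, ‖taylorCoeff g (k + 1)‖ * r ^ (k + 1) ≤ boundaryDist f

/-- The positive roots `r` of `f̂₀(r) = r_*`, where `f̂₀(r) = ∑ |t_n| r^n` is the majorant series of
the function `f₀ = ∑ t_n z^n` and `r_*` is the Koebe radius. -/
def majorantRoots (ψ : ℂ → ℂ) : Set ℝ :=
  {r : ℝ | 0 < r ∧ HasSum (fun n : ℕ => ‖taylorCoeff (extremal ψ) n‖ * r ^ n) (koebeRadius ψ)}

end MaMinda

end

/-! Every f in the class is z exp H(z) with z H' = ψ(w) - 1 for a Schwarz function w; the choice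
w(z) = z gives f₀ = z exp h. It suffices to show that d(0, ∂f(𝔻)) is at least r_*, and that for r ≤
1/3 the majorant series of every g ≺ f is at most f̂₀(r).

Distance: a minimum principle gives |f(z)| ≥ -f₀(-|z|) (`re_log_extremal_le`). Hence r_* is the
limit of -f₀(-r) as r → 1, and f₀ itself omits the value -r_* (`koebeRadius_eq`,
`radialSup_le_boundaryDist`, `boundaryDist_extremal`).

Majorants: passing from g to f is Bohr's inequality for a Schwarz function at radius 1/3
(`Subordinate.majSum_le`). Passing from f to f₀ would be the same argument if f/z were subordinate
to f₀/z, but ψ(𝔻) is not assumed convex or starlike, so that subordination is not available. There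
is still a germ v = h⁻¹ ∘ H at 0, and all that is needed of it is ∑ |v_n| 3⁻ⁿ ≤ 1/3. Writing ψ - 1 =
ψ'(0) z exp Λ, the germ solves z v' = w exp(Λ(w) - Λ(v)). Univalence and symmetry make ψ - 1
typically real, which bounds the coefficients of Λ (`IsMaMinda.exists_log_slope`). Induction on the
truncation order then bounds v and w - v together (`IsComparison.majSum_le_third`).

The root: -f₀(-r) has the terms of f₀(r) with alternating signs, so f̂₀ passes r_* before r = 1. It
is strictly increasing, which gives uniqueness of the root and sharpness. -/

namespace MaMinda

open Filter Topology PowerSeries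

/-! ### Taylor series at the origin as formal power series. -/

section

/-- The Taylor series at the origin as a formal power series. -/
noncomputable def taylorPS (f : ℂ → ℂ) : PowerSeries ℂ := PowerSeries.mk (taylorCoeff f)

@[simp]
theorem coeff_taylorPS (f : ℂ → ℂ) (n : ℕ) : coeff n (taylorPS f) = taylorCoeff f n :=
  coeff_mk _ _

theorem taylorCoeff_congr {f g : ℂ → ℂ} (h : f =ᶠ[𝓝 0] g) (n : ℕ) :
    taylorCoeff f n = taylorCoeff g n := by
  rw [taylorCoeff, taylorCoeff, h.iteratedDeriv_eq n]

theorem taylorPS_congr {f g : ℂ → ℂ} (h : f =ᶠ[𝓝 0] g) : taylorPS f = taylorPS g := by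
  ext n; simp [taylorCoeff_congr h n]

theorem taylorCoeff_eq_of_hasSum {f : ℂ → ℂ} {a : ℕ → ℂ}
    (h : ∀ᶠ z in 𝓝 (0 : ℂ), HasSum (fun n => a n * z ^ n) (f z)) (n : ℕ) :
    taylorCoeff f n = a n := by
  have h1 : HasFPowerSeriesAt f (FormalMultilinearSeries.ofScalars ℂ a) 0 := by
    rw [hasFPowerSeriesAt_iff]
    filter_upwards [h] with z hz
    simpa [mul_comm] using hz
  have h2 := h1.analyticAt.hasFPowerSeriesAt
  have h3 := h2.eq_formalMultilinearSeries h1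
  have h4 := congrArg (fun p => p.coeff n) h3
  simpa [taylorCoeff] using h4

theorem hasSum_taylorCoeff {f : ℂ → ℂ} {ρ : ℝ} (hf : DifferentiableOn ℂ f (ball 0 ρ)) {z : ℂ}
    (hz : z ∈ ball (0 : ℂ) ρ) : HasSum (fun n => taylorCoeff f n * z ^ n) (f z) := by
  have := Complex.hasSum_taylorSeries_on_ball hf hz
  convert! this using 2 with n
  simp [taylorCoeff, div_eq_inv_mul]
  ring

theorem analyticAt_zero {f : ℂ → ℂ} (hf : DifferentiableOn ℂ f disk) : AnalyticAt ℂ f 0 :=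
  hf.analyticAt (ball_mem_nhds _ one_pos)

@[simp]
theorem taylorCoeff_zero (f : ℂ → ℂ) : taylorCoeff f 0 = f 0 := by simp [taylorCoeff]

theorem taylorCoeff_one (f : ℂ → ℂ) : taylorCoeff f 1 = deriv f 0 := by
  simp [taylorCoeff, iteratedDeriv_one]

theorem taylorCoeff_deriv (f : ℂ → ℂ) (n : ℕ) :
    taylorCoeff (deriv f) n = (n + 1) * taylorCoeff f (n + 1) := by
  simp only [taylorCoeff, iteratedDeriv_succ', Nat.factorial_succ]
  have : (n.factorial : ℂ) ≠ 0 := by exact_mod_cast n.factorial_ne_zero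
  have : (n + 1 : ℂ) ≠ 0 := by exact_mod_cast n.succ_ne_zero
  push_cast
  field_simp

theorem taylorPS_mul {f g : ℂ → ℂ} (hf : AnalyticAt ℂ f 0) (hg : AnalyticAt ℂ g 0) :
    taylorPS (fun z => f z * g z) = taylorPS f * taylorPS g := by
  ext n
  rw [coeff_mul, coeff_taylorPS, taylorCoeff,
    iteratedDeriv_fun_mul hf.contDiffAt hg.contDiffAt,
    Finset.Nat.sum_antidiagonal_eq_sum_range_succ_mk, Finset.sum_div]
  refine Finset.sum_congr rfl fun i hi => ?_
  have hi' : i ≤ n := Nat.lt_succ_iff.mp (Finset.mem_range.mp hi)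
  simp only [coeff_taylorPS, taylorCoeff]
  have h1 : (n.factorial : ℂ) ≠ 0 := by exact_mod_cast n.factorial_ne_zero
  have h2 : (i.factorial : ℂ) ≠ 0 := by exact_mod_cast i.factorial_ne_zero
  have h3 : ((n - i).factorial : ℂ) ≠ 0 := by exact_mod_cast (n - i).factorial_ne_zero
  have h4 : (n.choose i : ℂ) * i.factorial * (n - i).factorial = n.factorial := by
    exact_mod_cast Nat.choose_mul_factorial_mul_factorial hi'
  rw [← h4] at h1 ⊢
  have h5 : (n.choose i : ℂ) ≠ 0 := by
    intro h; simp [h] at h1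
  field_simp

theorem taylorPS_add {f g : ℂ → ℂ} (hf : AnalyticAt ℂ f 0) (hg : AnalyticAt ℂ g 0) :
    taylorPS (fun z => f z + g z) = taylorPS f + taylorPS g := by
  ext n
  simp only [map_add, coeff_taylorPS, taylorCoeff]
  rw [iteratedDeriv_fun_add hf.contDiffAt hg.contDiffAt, add_div]

theorem taylorPS_sub {f g : ℂ → ℂ} (hf : AnalyticAt ℂ f 0) (hg : AnalyticAt ℂ g 0) :
    taylorPS (fun z => f z - g z) = taylorPS f - taylorPS g := by
  ext n
  simp only [map_sub, coeff_taylorPS, taylorCoeff]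
  rw [iteratedDeriv_fun_sub hf.contDiffAt hg.contDiffAt, sub_div]

theorem taylorPS_const (a : ℂ) : taylorPS (fun _ => a) = C a := by
  ext n
  simp only [coeff_taylorPS, taylorCoeff, coeff_C, iteratedDeriv_const]
  split_ifs with h <;> simp [h]

theorem taylorPS_id : taylorPS (fun z => z) = X := by
  ext n
  simp only [coeff_taylorPS, taylorCoeff, coeff_X, iteratedDeriv_fun_id_zero]
  split_ifs with h <;> simp [h]

theorem analyticAt_dslope {f : ℂ → ℂ} (hf : AnalyticAt ℂ f 0) : AnalyticAt ℂ (dslope f 0) 0 := by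
  obtain ⟨p, hp⟩ := hf
  exact ⟨_, hp.has_fpower_series_dslope_fslope⟩

theorem self_eq_add_mul_dslope (f : ℂ → ℂ) (z : ℂ) : f z = f 0 + z * dslope f 0 z := by
  have := sub_smul_dslope f 0 z
  simp only [sub_zero, smul_eq_mul] at this
  rw [this]; ring

theorem taylorPS_eq_add_X_mul {f : ℂ → ℂ} (hf : AnalyticAt ℂ f 0) :
    taylorPS f = C (f 0) + X * taylorPS (dslope f 0) := by
  rw [← taylorPS_const, ← taylorPS_id, ← taylorPS_mul (f := fun z => z) analyticAt_id (analyticAt_dslope hf),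
    ← taylorPS_add analyticAt_const (AnalyticAt.fun_mul (f := fun z => z) analyticAt_id (analyticAt_dslope hf))]
  congr 1
  funext z
  exact self_eq_add_mul_dslope f z

theorem taylorCoeff_dslope {f : ℂ → ℂ} (hf : AnalyticAt ℂ f 0) (n : ℕ) :
    taylorCoeff (dslope f 0) n = taylorCoeff f (n + 1) := by
  have := congrArg (coeff (n + 1)) (taylorPS_eq_add_X_mul hf)
  simpa [coeff_succ_X_mul, coeff_C] using this.symm

theorem X_dvd_taylorPS {g : ℂ → ℂ} (h0 : g 0 = 0) : X ∣ taylorPS g := by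
  rw [X_dvd_iff, ← coeff_zero_eq_constantCoeff_apply]
  simp [h0]

/-- Peeling off f = f(0) + z · `dslope f 0` and substituting g gains one factor of X per step,
because g vanishes at 0. Compositions are thus handled as congruences modulo X^K, without any
convergence question. -/
theorem X_pow_dvd_taylorPS_comp {g : ℂ → ℂ} (hg : AnalyticAt ℂ g 0) (h0 : g 0 = 0) (K : ℕ) :
    ∀ {f : ℂ → ℂ}, AnalyticAt ℂ f 0 → X ^ K ∣ taylorPS (fun z => f (g z)) -
      ∑ n ∈ Finset.range K, C (taylorCoeff f n) * taylorPS g ^ n := by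
  induction K with
  | zero => intro f _; simp
  | succ K ih =>
    intro f hf
    have hd := analyticAt_dslope hf
    have hdg : AnalyticAt ℂ (fun z => dslope f 0 (g z)) 0 :=
      AnalyticAt.fun_comp (by rwa [h0]) hg
    have h1 : taylorPS (fun z => f (g z)) =
        C (f 0) + taylorPS g * taylorPS (fun z => dslope f 0 (g z)) := by
      rw [← taylorPS_mul hg hdg, ← taylorPS_const,
        ← taylorPS_add analyticAt_const (hg.fun_mul hdg)]
      congr 1
      funext z
      exact self_eq_add_mul_dslope f (g z)
    have h2 : taylorPS (fun z => f (g z)) -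
        ∑ n ∈ Finset.range (K + 1), C (taylorCoeff f n) * taylorPS g ^ n =
        taylorPS g * (taylorPS (fun z => dslope f 0 (g z)) -
          ∑ n ∈ Finset.range K, C (taylorCoeff (dslope f 0) n) * taylorPS g ^ n) := by
      rw [h1, Finset.sum_range_succ', mul_sub, Finset.mul_sum]
      simp only [taylorCoeff_dslope hf, pow_zero, taylorCoeff_zero, mul_one]
      have : ∀ n, C (taylorCoeff f (n + 1)) * taylorPS g ^ (n + 1) =
        taylorPS g * (C (taylorCoeff f (n + 1)) * taylorPS g ^ n) := fun n => by ring
      simp only [this]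
      ring
    rw [h2, pow_succ']
    exact mul_dvd_mul (X_dvd_taylorPS h0) (ih hd)

/-! ### Truncated majorant sums as submultiplicative seminorms. -/

/-- The truncated majorant sum `∑_{n < N} ‖P_n‖ r ^ n`. -/
noncomputable def majSum (r : ℝ) (N : ℕ) (P : PowerSeries ℂ) : ℝ :=
  ∑ n ∈ Finset.range N, ‖coeff n P‖ * r ^ n

theorem majSum_nonneg {r : ℝ} (hr : 0 ≤ r) {N : ℕ} (P : PowerSeries ℂ) : 0 ≤ majSum r N P :=
  Finset.sum_nonneg fun _ _ => by positivity

theorem majSum_add_le {r : ℝ} (hr : 0 ≤ r) {N : ℕ} (P Q : PowerSeries ℂ) :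
    majSum r N (P + Q) ≤ majSum r N P + majSum r N Q := by
  rw [majSum, majSum, majSum, ← Finset.sum_add_distrib]
  refine Finset.sum_le_sum fun n _ => ?_
  rw [← add_mul, map_add]
  gcongr
  exact norm_add_le _ _

/-- The truncated Cauchy product only sees index pairs with sum below N, a subset of the square over
which the right side is summed. -/
theorem majSum_mul_le {r : ℝ} (hr : 0 ≤ r) {N : ℕ} (P Q : PowerSeries ℂ) :
    majSum r N (P * Q) ≤ majSum r N P * majSum r N Q := by
  calc majSum r N (P * Q)
      ≤ ∑ n ∈ Finset.range N, ∑ p ∈ Finset.HasAntidiagonal.antidiagonal n,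
          (‖coeff p.1 P‖ * r ^ p.1) * (‖coeff p.2 Q‖ * r ^ p.2) := by
        refine Finset.sum_le_sum fun n _ => ?_
        rw [coeff_mul]
        calc _ ≤ (∑ p ∈ Finset.HasAntidiagonal.antidiagonal n, ‖coeff p.1 P * coeff p.2 Q‖) * r ^ n := by
              gcongr; exact norm_sum_le _ _
          _ = _ := by
              rw [Finset.sum_mul]
              refine Finset.sum_congr rfl fun p hp => ?_
              rw [← Finset.HasAntidiagonal.mem_antidiagonal.mp hp, norm_mul, pow_add]; ring
    _ = ∑ p ∈ (Finset.range N ×ˢ Finset.range N) with p.1 + p.2 < N,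
          (‖coeff p.1 P‖ * r ^ p.1) * (‖coeff p.2 Q‖ * r ^ p.2) := by
        rw [Finset.sum_sigma']
        refine Finset.sum_bij' (fun x _ => x.2) (fun p _ => ⟨p.1 + p.2, p⟩) ?_ ?_ ?_ ?_ ?_
        · rintro ⟨n, p⟩ h
          simp only [Finset.mem_sigma, Finset.mem_range, Finset.HasAntidiagonal.mem_antidiagonal] at h
          simp only [Finset.mem_filter, Finset.mem_product, Finset.mem_range]
          omega
        · rintro ⟨a, b⟩ h
          simp only [Finset.mem_filter, Finset.mem_product, Finset.mem_range] at h
          simp only [Finset.mem_sigma, Finset.mem_range, Finset.HasAntidiagonal.mem_antidiagonal]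
          exact ⟨h.2, trivial⟩
        · rintro ⟨n, p⟩ h
          simp only [Finset.mem_sigma, Finset.mem_range, Finset.HasAntidiagonal.mem_antidiagonal] at h
          obtain ⟨_, rfl⟩ := h
          rfl
        · intros; rfl
        · intros; rfl
    _ ≤ ∑ p ∈ (Finset.range N ×ˢ Finset.range N),
          (‖coeff p.1 P‖ * r ^ p.1) * (‖coeff p.2 Q‖ * r ^ p.2) :=
        Finset.sum_le_sum_of_subset_of_nonneg (Finset.filter_subset _ _)
          fun _ _ _ => by positivity
    _ = _ := by rw [Finset.sum_product, majSum, majSum, Finset.sum_mul_sum]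

theorem majSum_C_mul {r : ℝ} {N : ℕ} (a : ℂ) (P : PowerSeries ℂ) :
    majSum r N (C a * P) = ‖a‖ * majSum r N P := by
  simp only [majSum, coeff_C_mul, norm_mul, Finset.mul_sum, mul_assoc]

theorem majSum_sum_le {r : ℝ} (hr : 0 ≤ r) {N : ℕ} {ι : Type*} (s : Finset ι)
    (P : ι → PowerSeries ℂ) :
    majSum r N (∑ i ∈ s, P i) ≤ ∑ i ∈ s, majSum r N (P i) := by
  classical
  induction s using Finset.induction_on with
  | empty => simp [majSum]
  | insert i s hi ih =>
    rw [Finset.sum_insert hi, Finset.sum_insert hi]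
    exact (majSum_add_le hr _ _).trans (by gcongr)

theorem majSum_one_le {r : ℝ} {N : ℕ} : majSum r N 1 ≤ 1 := by
  cases N with
  | zero => simp [majSum]
  | succ N => rw [majSum, Finset.sum_range_succ']; simp [coeff_one]

theorem majSum_pow_le {r : ℝ} (hr : 0 ≤ r) {N : ℕ} (P : PowerSeries ℂ) (k : ℕ) :
    majSum r N (P ^ k) ≤ majSum r N P ^ k := by
  induction k with
  | zero => simpa using majSum_one_le
  | succ k ih =>
    rw [pow_succ, pow_succ]
    refine (majSum_mul_le hr _ _).trans ?_
    have := majSum_nonneg hr (N := N) P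
    gcongr

theorem majSum_X_mul {r : ℝ} {N : ℕ} (P : PowerSeries ℂ) :
    majSum r (N + 1) (X * P) = r * majSum r N P := by
  rw [majSum, Finset.sum_range_succ', majSum, Finset.mul_sum]
  simp only [coeff_succ_X_mul, coeff_zero_X_mul, norm_zero, zero_mul, add_zero]
  exact Finset.sum_congr rfl fun n _ => by ring

theorem majSum_mono {r : ℝ} (hr : 0 ≤ r) {N : ℕ} {M : ℕ} (h : M ≤ N) (P : PowerSeries ℂ) :
    majSum r M P ≤ majSum r N P :=
  Finset.sum_le_sum_of_subset_of_nonneg (by simpa using h) fun _ _ _ => by positivity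

theorem majSum_congr {r : ℝ} {N : ℕ} {P Q : PowerSeries ℂ} (h : X ^ N ∣ P - Q) :
    majSum r N P = majSum r N Q := by
  refine Finset.sum_congr rfl fun n hn => ?_
  have := (X_pow_dvd_iff.mp h) n (Finset.mem_range.mp hn)
  rw [map_sub, sub_eq_zero] at this
  rw [this]

/-- The cofactor of P - Q in P^k - Q^k has k terms, each of majorant at most ρ^(k-1). This Lipschitz
estimate turns a bound on w - v into one on Λ(w) - Λ(v). -/
theorem majSum_pow_sub_pow_le {r : ℝ} (hr : 0 ≤ r) {N : ℕ} {P Q : PowerSeries ℂ} {ρ : ℝ}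
    (hP : majSum r N P ≤ ρ)
    (hQ : majSum r N Q ≤ ρ) (k : ℕ) :
    majSum r N (P ^ k - Q ^ k) ≤ k * ρ ^ (k - 1) * majSum r N (P - Q) := by
  have hP0 := majSum_nonneg hr (N := N) P
  have hQ0 := majSum_nonneg hr (N := N) Q
  have hd0 := majSum_nonneg hr (N := N) (P - Q)
  rw [← (Commute.all P Q).geom_sum₂_mul]
  refine (majSum_mul_le hr _ _).trans ?_
  gcongr
  refine (majSum_sum_le hr _ _).trans ?_
  rw [← Finset.card_range k, ← nsmul_eq_mul, Finset.card_range]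
  nth_rewrite 3 [← Finset.card_range k]
  refine Finset.sum_le_card_nsmul _ _ _ fun i hi => ?_
  have hi' := Finset.mem_range.mp hi
  calc majSum r N (P ^ i * Q ^ (k - 1 - i)) ≤ majSum r N P ^ i * majSum r N Q ^ (k - 1 - i) :=
        (majSum_mul_le hr _ _).trans (mul_le_mul (majSum_pow_le hr _ _) (majSum_pow_le hr _ _)
          (majSum_nonneg hr _) (by positivity))
    _ ≤ ρ ^ i * ρ ^ (k - 1 - i) := by
        have : 0 ≤ ρ := hP0.trans hP
        gcongr
    _ = ρ ^ (k - 1) := by rw [← pow_add]; congr 1; omega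

/-- Only the majorant of the inner germ enters, not its mapping properties; so the bound serves both
Schwarz functions and the comparison germ v. -/
theorem majSum_comp_le {r : ℝ} (hr : 0 ≤ r) {N : ℕ} {f g : ℂ → ℂ} (hf : AnalyticAt ℂ f 0)
    (hg : AnalyticAt ℂ g 0)
    (h0 : g 0 = 0) : majSum r N (taylorPS fun z => f (g z)) ≤
      ∑ n ∈ Finset.range N, ‖taylorCoeff f n‖ * majSum r N (taylorPS g) ^ n := by
  rw [majSum_congr (X_pow_dvd_taylorPS_comp hg h0 N hf)]
  refine (majSum_sum_le hr _ _).trans (Finset.sum_le_sum fun n _ => ?_)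
  rw [majSum_C_mul]
  gcongr
  exact majSum_pow_le hr _ _

end

/-! ### Coefficient bounds for bounded functions and for functions with positive real part. -/

section

theorem norm_taylorCoeff_le_one {f : ℂ → ℂ} (hf : DifferentiableOn ℂ f disk)
    (hb : ∀ z ∈ disk, ‖f z‖ ≤ 1) (n : ℕ) : ‖taylorCoeff f n‖ ≤ 1 := by
  have h : ∀ᶠ ρ in 𝓝[<] (1 : ℝ), ‖taylorCoeff f n‖ * ρ ^ n ≤ 1 := by
    filter_upwards [Ioo_mem_nhdsLT (zero_lt_one' ℝ)] with ρ hρ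
    have h1 := norm_iteratedDeriv_le_of_forall_mem_sphere_norm_le (c := (0 : ℂ)) n hρ.1
      ((hf.mono (closedBall_subset_ball hρ.2)).diffContOnCl_ball subset_rfl) (C := 1)
      (fun z hz => hb z (sphere_subset_ball hρ.2 hz))
    have h2 : (0 : ℝ) < n.factorial := by exact_mod_cast n.factorial_pos
    have h3 : (0 : ℝ) < ρ ^ n := pow_pos hρ.1 n
    rw [le_div_iff₀ h3] at h1
    rw [taylorCoeff, norm_div, Complex.norm_natCast, div_mul_eq_mul_div, div_le_one h2]
    simpa using h1
  have ht : Tendsto (fun ρ : ℝ => ‖taylorCoeff f n‖ * ρ ^ n) (𝓝[<] 1) (𝓝 (‖taylorCoeff f n‖)) := by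
    have : ContinuousAt (fun ρ : ℝ => ‖taylorCoeff f n‖ * ρ ^ n) 1 := by fun_prop
    simpa using this.tendsto.mono_left nhdsWithin_le_nhds
  exact le_of_tendsto ht h

/-- Averaging over the rotations by `n`-th roots of unity kills the coefficients strictly between
`0` and `n`. -/
theorem exists_rotation_average {f : ℂ → ℂ} (hf : DifferentiableOn ℂ f disk) {n : ℕ} (hn : n ≠ 0) :
    ∃ g : ℂ → ℂ, DifferentiableOn ℂ g disk ∧ g 0 = f 0 ∧
      (∀ j, 0 < j → j < n → taylorCoeff g j = 0) ∧ taylorCoeff g n = taylorCoeff f n ∧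
      ∀ S : Set ℂ, Convex ℝ S → MapsTo f disk S → MapsTo g disk S := by
  obtain ⟨ζ, hζ⟩ : ∃ ζ : ℂ, IsPrimitiveRoot ζ n := ⟨_, Complex.isPrimitiveRoot_exp n hn⟩
  have hζn : ‖ζ‖ = 1 := hζ.norm'_eq_one hn
  have hmaps : ∀ k : ℕ, MapsTo (fun z => ζ ^ k * z) disk disk := by
    intro k z hz
    simpa [disk, hζn] using hz
  have hnz : (n : ℝ) ≠ 0 := by exact_mod_cast hn
  have hnc : (n : ℂ) ≠ 0 := by exact_mod_cast hn
  set g : ℂ → ℂ := fun z => ∑ k ∈ Finset.range n, (1 / n : ℝ) • f (ζ ^ k * z) with hg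
  have hco : ∀ j, taylorCoeff g j =
      (∑ k ∈ Finset.range n, (1 / n : ℝ) • (ζ ^ j) ^ k) * taylorCoeff f j := by
    apply taylorCoeff_eq_of_hasSum
    filter_upwards [ball_mem_nhds (0 : ℂ) one_pos] with z hz
    have : ∀ k ∈ Finset.range n, HasSum (fun j => (1 / n : ℝ) • (taylorCoeff f j * (ζ ^ k * z) ^ j))
        ((1 / n : ℝ) • f (ζ ^ k * z)) := fun k _ =>
      (hasSum_taylorCoeff hf (hmaps k hz)).const_smul _
    convert! hasSum_sum this using 2 with j
    rw [Finset.sum_mul, Finset.sum_mul]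
    refine Finset.sum_congr rfl fun k _ => ?_
    simp only [Complex.real_smul, mul_pow, ← pow_mul, mul_comm j k]
    ring
  refine ⟨g, ?_, ?_, ?_, ?_, ?_⟩
  · refine DifferentiableOn.fun_sum fun k _ => DifferentiableOn.fun_const_smul ?_ _
    exact hf.comp (by fun_prop) (hmaps k)
  · simp [hg, hnc]
  · intro j hj hjn
    have h1 : ζ ^ j ≠ 1 := hζ.pow_ne_one_of_pos_of_lt hj.ne' hjn
    have h2 : ∑ k ∈ Finset.range n, (ζ ^ j) ^ k = 0 := by
      have := mul_geom_sum (ζ ^ j) n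
      rw [← pow_mul, mul_comm j n, pow_mul, hζ.pow_eq_one, one_pow, sub_self] at this
      exact (mul_eq_zero.mp this).resolve_left (sub_ne_zero.mpr h1)
    rw [hco, ← Finset.smul_sum, h2]; simp
  · rw [hco]; simp [hζ.pow_eq_one, hnc]
  · intro S hS hfS z hz
    refine hS.sum_mem (fun _ _ => by positivity) ?_ (fun k _ => hfS (hmaps k hz))
    simp [hnz]

/-- If `(u * g + v) * χ = g - g 0` with `‖χ‖ ≤ 1`, and the coefficients of `g` strictly between `0`
and `n` vanish, then `‖g_n‖ ≤ ‖u * g 0 + v‖`. -/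
theorem norm_taylorCoeff_le_of_mul_eq {g χ : ℂ → ℂ} (hg : DifferentiableOn ℂ g disk)
    (hχ : DifferentiableOn ℂ χ disk) (hb : ∀ z ∈ disk, ‖χ z‖ ≤ 1) {u v : ℂ} {n : ℕ} (hn : n ≠ 0)
    (h0 : u * g 0 + v ≠ 0) (hgj : ∀ j, 0 < j → j < n → taylorCoeff g j = 0)
    (heq : ∀ z ∈ disk, (u * g z + v) * χ z = g z - g 0) :
    ‖taylorCoeff g n‖ ≤ ‖u * g 0 + v‖ := by
  have hga := analyticAt_zero hg
  have hχa := analyticAt_zero hχ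
  have h1 : taylorPS (fun z => u * g z + v) * taylorPS χ = taylorPS g - C (g 0) := by
    rw [← taylorPS_mul (by fun_prop) hχa, ← taylorPS_const, ← taylorPS_sub hga analyticAt_const]
    refine taylorPS_congr ?_
    filter_upwards [ball_mem_nhds (0 : ℂ) one_pos] with z hz using heq z hz
  have h2 : taylorPS (fun z => u * g z + v) = C u * taylorPS g + C v := by
    rw [← taylorPS_const, ← taylorPS_const, ← taylorPS_mul analyticAt_const hga,
      ← taylorPS_add (by fun_prop) analyticAt_const]
  have hk : ∀ j, 0 < j → j < n → coeff j (taylorPS (fun z => u * g z + v)) = 0 := by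
    intro j hj hjn
    rw [h2]; simp [coeff_C, hj.ne', hgj j hj hjn]
  have hc0 : coeff 0 (taylorPS (fun z => u * g z + v)) = u * g 0 + v := by simp
  have hχ0 : χ 0 = 0 := by
    have := heq 0 (mem_ball_self one_pos)
    rw [sub_self] at this
    exact (mul_eq_zero.mp this).resolve_left h0
  have h3 := congrArg (coeff n) h1
  -- Only the pair (0, n) survives: χ(0) = 0 removes b = 0, and the vanishing coefficients of g
  -- remove 0 < a < n.
  rw [coeff_mul, Finset.sum_eq_single (0, n)] at h3
  · rw [hc0] at h3
    simp only [coeff_taylorPS, map_sub, coeff_C, hn, if_false, sub_zero] at h3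
    rw [← h3, norm_mul]
    exact mul_le_of_le_one_right (norm_nonneg _) (norm_taylorCoeff_le_one hχ hb n)
  · rintro ⟨a, b⟩ hab hne
    have hab' : a + b = n := Finset.HasAntidiagonal.mem_antidiagonal.mp hab
    rcases Nat.eq_zero_or_pos b with hb0 | hb0
    · simp [hb0, hχ0]
    · rcases Nat.eq_zero_or_pos a with ha0 | ha0
      · exact absurd (by ext <;> simp <;> omega) hne
      · rw [hk a ha0 (by omega), zero_mul]
  · intro h; exact absurd (Finset.HasAntidiagonal.mem_antidiagonal.mpr (by simp)) h

/-- The coefficients of a function bounded by one. -/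
theorem norm_taylorCoeff_le_one_sub_sq {f : ℂ → ℂ} (hf : DifferentiableOn ℂ f disk)
    (hb : ∀ z ∈ disk, ‖f z‖ ≤ 1) {n : ℕ} (hn : n ≠ 0) :
    ‖taylorCoeff f n‖ ≤ 1 - ‖f 0‖ ^ 2 := by
  obtain ⟨g, hg, hg0, hgj, hgn, hgS⟩ := exists_rotation_average hf hn
  have hgb : ∀ z ∈ disk, ‖g z‖ ≤ 1 := fun z hz => by
    simpa using hgS (closedBall 0 1) (convex_closedBall _ _) (fun z hz => by simpa using hb z hz) hz
  have h00 : (0 : ℂ) ∈ disk := mem_ball_self one_pos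
  rcases (hb 0 h00).lt_or_eq with hlt | heq
  · set c := f 0
    have hsq : ‖c‖ ^ 2 < 1 := by nlinarith [norm_nonneg c]
    have hden : ∀ z ∈ disk, -(starRingEnd ℂ) c * g z + 1 ≠ 0 := by
      intro z hz h
      have h1 : ‖(starRingEnd ℂ) c * g z‖ = 1 := by
        have : (starRingEnd ℂ) c * g z = 1 := by linear_combination -h
        rw [this, norm_one]
      rw [norm_mul, RCLike.norm_conj] at h1
      nlinarith [norm_nonneg c, norm_nonneg (g z), hgb z hz]
    have hcc : -(starRingEnd ℂ) c * g 0 + 1 = ((1 - ‖c‖ ^ 2 : ℝ) : ℂ) := by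
      rw [hg0, neg_mul, mul_comm, Complex.mul_conj, Complex.normSq_eq_norm_sq]; push_cast; ring
    -- χ is g followed by the disk automorphism that sends c to 0; its denominator at the origin is
    -- 1 - ‖c‖².
    have key := norm_taylorCoeff_le_of_mul_eq (χ := fun z => (g z - c) / (-(starRingEnd ℂ) c * g z + 1))
      (u := -(starRingEnd ℂ) c) (v := 1) hg ((hg.sub_const _).div (by fun_prop) hden) ?_ hn
      (hden 0 h00) hgj ?_
    · rwa [hcc, Complex.norm_real, Real.norm_of_nonneg (by linarith), hgn] at key
    · intro z hz
      rw [norm_div, div_le_one (norm_pos_iff.mpr (hden z hz)), ← sq_le_sq₀ (norm_nonneg _)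
        (norm_nonneg _), ← Complex.normSq_eq_norm_sq, ← Complex.normSq_eq_norm_sq]
      have h1 : normSq (-(starRingEnd ℂ) c * g z + 1) - normSq (g z - c) =
          (1 - normSq c) * (1 - normSq (g z)) := by
        simp only [normSq_apply]
        simp
        ring
      have h2 : normSq (g z) ≤ 1 := by
        rw [normSq_eq_norm_sq]; nlinarith [hgb z hz, norm_nonneg (g z)]
      have h3 : normSq c ≤ 1 := by rw [normSq_eq_norm_sq]; exact hsq.le
      nlinarith
    · intro z hz
      rw [hg0, mul_div_cancel₀ _ (hden z hz)]
  · have hconst : EqOn f (Function.const ℂ (f 0)) disk :=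
      Complex.eqOn_of_isPreconnected_of_isMaxOn_norm (convex_ball _ _).isPreconnected isOpen_ball hf
        h00 (fun z hz => by simpa [heq] using hb z hz)
    have : taylorCoeff f n = taylorCoeff (fun _ => f 0) n :=
      taylorCoeff_congr (by
        filter_upwards [ball_mem_nhds (0 : ℂ) one_pos] with z hz using hconst hz) n
    rw [this, ← coeff_taylorPS, taylorPS_const, coeff_C, if_neg hn, heq]
    simp

/-- Carathéodory's inequality for the coefficients of a function with positive real part. -/
theorem norm_taylorCoeff_le_two_mul_re {f : ℂ → ℂ} (hf : DifferentiableOn ℂ f disk)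
    (hp : ∀ z ∈ disk, 0 ≤ (f z).re) (h0 : 0 < (f 0).re) {n : ℕ} (hn : n ≠ 0) :
    ‖taylorCoeff f n‖ ≤ 2 * (f 0).re := by
  obtain ⟨g, hg, hg0, hgj, hgn, hgS⟩ := exists_rotation_average hf hn
  have hgb : ∀ z ∈ disk, 0 ≤ (g z).re := fun z hz =>
    hgS {z | 0 ≤ z.re} (convex_halfSpace_re_ge 0) hp hz
  set a := f 0
  have hden : ∀ z ∈ disk, 1 * g z + (starRingEnd ℂ) a ≠ 0 := by
    intro z hz h
    have := congrArg re h
    simp at this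
    linarith [hgb z hz]
  have hcc : 1 * g 0 + (starRingEnd ℂ) a = ((2 * a.re : ℝ) : ℂ) := by
    rw [hg0, one_mul, Complex.add_conj]
  -- Here χ is g followed by the Cayley transform of the right half-plane that sends a to 0; its
  -- denominator at the origin is 2 Re a.
  have key := norm_taylorCoeff_le_of_mul_eq (χ := fun z => (g z - a) / (1 * g z + (starRingEnd ℂ) a))
    (u := 1) (v := (starRingEnd ℂ) a) hg ((hg.sub_const _).div (by fun_prop) hden) ?_ hn
    (hden 0 (mem_ball_self one_pos)) hgj ?_
  · rwa [hcc, Complex.norm_real, Real.norm_of_nonneg (by linarith), hgn] at key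
  · intro z hz
    rw [norm_div, div_le_one (norm_pos_iff.mpr (hden z hz)), ← sq_le_sq₀ (norm_nonneg _)
      (norm_nonneg _), ← Complex.normSq_eq_norm_sq, ← Complex.normSq_eq_norm_sq]
    have h1 : normSq (1 * g z + (starRingEnd ℂ) a) - normSq (g z - a) =
        4 * (a.re * (g z).re) := by
      simp only [normSq_apply]
      simp
      ring
    have := mul_nonneg h0.le (hgb z hz)
    linarith
  · intro z hz
    rw [hg0, mul_div_cancel₀ _ (hden z hz)]

end

/-! ### Inverses of univalent functions, and real symmetry of ψ. -/

section

theorem zero_mem_disk : (0 : ℂ) ∈ disk := mem_ball_self one_pos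

theorem mem_disk_iff {z : ℂ} : z ∈ disk ↔ ‖z‖ < 1 := by simp [disk]

theorem isOpen_disk : IsOpen disk := isOpen_ball

theorem isPreconnected_disk : IsPreconnected disk := (convex_ball _ _).isPreconnected

theorem isOpen_image_of_injOn {f : ℂ → ℂ} (hf : DifferentiableOn ℂ f disk) (hi : InjOn f disk)
    {s : Set ℂ} (hs : s ⊆ disk) (ho : IsOpen s) : IsOpen (f '' s) := by
  rcases (hf.analyticOnNhd isOpen_disk).is_constant_or_isOpen isPreconnected_disk with ⟨w, hw⟩ | h
  · exfalso
    have h2 : (1 / 2 : ℂ) ∈ disk := by rw [mem_disk_iff]; norm_num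
    have := hi zero_mem_disk h2 ((hw _ zero_mem_disk).trans (hw _ h2).symm)
    norm_num at this
  · exact h s hs ho

theorem continuousAt_invFunOn {f : ℂ → ℂ} (hf : DifferentiableOn ℂ f disk) (hi : InjOn f disk)
    {z : ℂ} (hz : z ∈ disk) : ContinuousAt (Function.invFunOn f disk) (f z) := by
  rw [ContinuousAt, hi.leftInvOn_invFunOn hz, tendsto_def]
  intro s hs
  obtain ⟨t, hts, hto, hzt⟩ := _root_.mem_nhds_iff.mp hs
  have ho : IsOpen (f '' (t ∩ disk)) :=
    isOpen_image_of_injOn hf hi inter_subset_right (hto.inter isOpen_disk)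
  refine mem_of_superset (ho.mem_nhds ⟨z, ⟨hzt, hz⟩, rfl⟩) ?_
  rintro _ ⟨x, ⟨hxt, hxd⟩, rfl⟩
  rw [mem_preimage, hi.leftInvOn_invFunOn hxd]
  exact hts hxt

/-- The inverse of a univalent function is analytic. -/
theorem differentiableAt_invFunOn {f : ℂ → ℂ} (hf : DifferentiableOn ℂ f disk)
    (hi : InjOn f disk) {z : ℂ} (hz : z ∈ disk) :
    DifferentiableAt ℂ (Function.invFunOn f disk) (f z) := by
  set η := Function.invFunOn f disk
  have hη : ∀ x ∈ disk, η (f x) = x := fun x hx => hi.leftInvOn_invFunOn hx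
  have himg : f '' disk ∈ 𝓝 (f z) :=
    (isOpen_image_of_injOn hf hi subset_rfl isOpen_disk).mem_nhds ⟨z, hz, rfl⟩
  have hdf : AnalyticAt ℂ (deriv f) z := (hf.analyticAt (isOpen_disk.mem_nhds hz)).deriv
  have hcont : ContinuousAt η (f z) := continuousAt_invFunOn hf hi hz
  have hreg : ∀ x ∈ disk, deriv f x ≠ 0 → DifferentiableAt ℂ η (f x) := by
    intro x hx hx'
    have h1 : HasDerivAt f (deriv f x) (η (f x)) := by
      rw [hη x hx]; exact (hf.differentiableAt (isOpen_disk.mem_nhds hx)).hasDerivAt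
    refine (h1.of_local_left_inverse (continuousAt_invFunOn hf hi hx) hx' ?_).differentiableAt
    filter_upwards [(isOpen_image_of_injOn hf hi subset_rfl isOpen_disk).mem_nhds ⟨x, hx, rfl⟩]
    rintro _ ⟨u, hu, rfl⟩
    exact congrArg f (hη u hu)
  rcases hdf.eventually_eq_zero_or_eventually_ne_zero with h0 | h0
  · exfalso
    obtain ⟨ε, hε, hball⟩ := Metric.eventually_nhds_iff_ball.mp
      (h0.and (isOpen_disk.mem_nhds hz))
    have hzε : z + (ε / 2 : ℝ) ∈ ball z ε := by
      simp [abs_of_pos hε]; linarith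
    have hc : f (z + (ε / 2 : ℝ)) = f z := by
      refine isOpen_ball.is_const_of_deriv_eq_zero (convex_ball z ε).isPreconnected
        (hf.mono fun x hx => (hball x hx).2) (fun x hx => (hball x hx).1) hzε (mem_ball_self hε)
    have := hi (hball _ hzε).2 hz hc
    simp at this
    exact hε.ne' this
  -- Zeros of f' are isolated, so the continuous inverse is differentiable on a punctured
  -- neighbourhood and the singularity is removable. No prior proof that f' has no zeros is needed.
  · refine (analyticAt_of_differentiable_on_punctured_nhds_of_continuousAt ?_ hcont).differentiableAt
    have ht : Tendsto η (𝓝[≠] (f z)) (𝓝[≠] z) := by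
      refine tendsto_nhdsWithin_iff.mpr ⟨?_, ?_⟩
      · have := hcont.tendsto
        rw [hη z hz] at this
        exact this.mono_left nhdsWithin_le_nhds
      · filter_upwards [nhdsWithin_le_nhds himg, self_mem_nhdsWithin]
        rintro _ ⟨x, hx, rfl⟩ hne
        rw [hη x hx]
        rintro rfl
        exact hne rfl
    filter_upwards [ht.eventually h0, nhdsWithin_le_nhds himg]
    rintro _ h1 ⟨x, hx, rfl⟩
    rw [hη x hx] at h1
    exact hreg x hx h1

theorem conj_mem_disk {z : ℂ} (hz : z ∈ disk) : (starRingEnd ℂ) z ∈ disk := by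
  simpa [mem_disk_iff] using hz

namespace IsMaMinda

variable {ψ : ℂ → ℂ}

/-- The reflected function conj ∘ ψ ∘ conj takes its values in ψ(𝔻). Composing it with ψ⁻¹ gives a
self-map of the disk fixing 0 with derivative 1, the equality case of the Schwarz lemma. -/
theorem map_conj (hψ : IsMaMinda ψ) {z : ℂ} (hz : z ∈ disk) :
    ψ ((starRingEnd ℂ) z) = (starRingEnd ℂ) (ψ z) := by
  set η := Function.invFunOn ψ disk
  have hη : ∀ x ∈ disk, η (ψ x) = x := fun x hx => hψ.univalent.leftInvOn_invFunOn hx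
  set s : ℂ → ℂ := (starRingEnd ℂ) ∘ ψ ∘ (starRingEnd ℂ)
  have hs : ∀ x ∈ disk, ∃ u ∈ disk, ψ u = s x := fun x hx =>
    hψ.symm _ ⟨_, conj_mem_disk hx, rfl⟩
  have hsd : ∀ x ∈ disk, DifferentiableAt ℂ s x := fun x hx =>
    differentiableAt_conj_conj_iff.mpr
      (hψ.analytic.differentiableAt (isOpen_disk.mem_nhds (conj_mem_disk hx)))
  have hφd : ∀ x ∈ disk, DifferentiableAt ℂ (η ∘ s) x := by
    intro x hx
    obtain ⟨u, hu, hux⟩ := hs x hx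
    refine DifferentiableAt.comp x ?_ (hsd x hx)
    rw [← hux]
    exact differentiableAt_invFunOn hψ.analytic hψ.univalent hu
  have hφm : MapsTo (η ∘ s) disk disk := by
    intro x hx
    obtain ⟨u, hu, hux⟩ := hs x hx
    simpa [← hux, hη u hu] using hu
  have hψφ : ∀ x ∈ disk, ψ ((η ∘ s) x) = s x := by
    intro x hx
    obtain ⟨u, hu, hux⟩ := hs x hx
    rw [Function.comp_apply, ← hux, hη u hu]
  have hφ0 : (η ∘ s) 0 = 0 := by
    have : s 0 = ψ 0 := by simp [s, hψ.map_zero]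
    rw [Function.comp_apply, this, hη 0 zero_mem_disk]
  have hd0 : deriv ψ 0 ≠ 0 := fun h => by simpa [h] using hψ.deriv_re_pos
  have hder : deriv (η ∘ s) 0 = 1 := by
    have h1 : HasDerivAt (ψ ∘ (η ∘ s)) (deriv ψ 0 * deriv (η ∘ s) 0) 0 := by
      refine HasDerivAt.comp 0 ?_ (hφd 0 zero_mem_disk).hasDerivAt
      rw [hφ0]
      exact (hψ.analytic.differentiableAt (isOpen_disk.mem_nhds zero_mem_disk)).hasDerivAt
    have h2 : HasDerivAt s (deriv ψ 0) 0 := by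
      have := (hsd 0 zero_mem_disk).hasDerivAt
      rw [deriv_conj_conj] at this
      simpa [Complex.conj_eq_iff_im.mpr hψ.deriv_im] using this
    have h3 : ψ ∘ (η ∘ s) =ᶠ[𝓝 0] s := by
      filter_upwards [isOpen_disk.mem_nhds zero_mem_disk] with x hx using hψφ x hx
    have h4 := (h1.congr_of_eventuallyEq h3.symm).unique h2
    exact mul_left_cancel₀ hd0 (h4.trans (mul_one _).symm)
  have hid := affine_of_mapsTo_ball_of_norm_dslope_eq_div (f := η ∘ s) (c := 0) (R₁ := 1) (R₂ := 1)
    (z₀ := 0) (fun x hx => (hφd x hx).differentiableWithinAt)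
    (by rw [hφ0]; exact fun x hx => ball_subset_closedBall (hφm hx)) zero_mem_disk
    (by rw [dslope_same, hder]; simp)
  have h5 := hid (conj_mem_disk hz)
  rw [hφ0, dslope_same, hder] at h5
  simp only [sub_zero, smul_eq_mul, mul_one, zero_add] at h5
  have h6 := hψφ _ (conj_mem_disk hz)
  rw [h5] at h6
  simpa [s] using h6

theorem ofReal_mem_disk {x : ℝ} (hx : x ∈ Ioo (-1 : ℝ) 1) : (x : ℂ) ∈ disk := by
  rw [mem_disk_iff, Complex.norm_real, Real.norm_eq_abs, abs_lt]
  exact hx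

theorem im_ofReal (hψ : IsMaMinda ψ) {x : ℝ} (hx : x ∈ Ioo (-1 : ℝ) 1) : (ψ x).im = 0 := by
  have := hψ.map_conj (ofReal_mem_disk hx)
  rw [Complex.conj_ofReal] at this
  exact Complex.conj_eq_iff_im.mp this.symm

theorem im_eq_zero_of_im_eq_zero (hψ : IsMaMinda ψ) {z : ℂ} (hz : z ∈ disk) (h : (ψ z).im = 0) :
    z.im = 0 := by
  have h1 := hψ.map_conj hz
  rw [Complex.conj_eq_iff_im.mpr h] at h1
  exact Complex.conj_eq_iff_im.mp (hψ.univalent (conj_mem_disk hz) hz h1)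

theorem hasDerivAt_zero (hψ : IsMaMinda ψ) : HasDerivAt ψ (((deriv ψ 0).re : ℝ) : ℂ) 0 := by
  have : (((deriv ψ 0).re : ℝ) : ℂ) = deriv ψ 0 := by
    apply Complex.ext <;> simp [hψ.deriv_im]
  rw [this]
  exact (hψ.analytic.differentiableAt (isOpen_disk.mem_nhds zero_mem_disk)).hasDerivAt

/-- A continuous injective real function on the diameter is strictly monotone, and ψ'(0) > 0 decides
the direction. -/
theorem strictMonoOn (hψ : IsMaMinda ψ) :
    StrictMonoOn (fun x : ℝ => (ψ x).re) (Ioo (-1 : ℝ) 1) := by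
  have hc : ContinuousOn (fun x : ℝ => (ψ x).re) (Ioo (-1 : ℝ) 1) :=
    Complex.continuous_re.comp_continuousOn
      (hψ.analytic.continuousOn.comp (by fun_prop) fun x hx => ofReal_mem_disk hx)
  have hi : InjOn (fun x : ℝ => (ψ x).re) (Ioo (-1 : ℝ) 1) := by
    intro x hx y hy hxy
    have : ψ x = ψ y := Complex.ext hxy (by rw [hψ.im_ofReal hx, hψ.im_ofReal hy])
    exact_mod_cast hψ.univalent (ofReal_mem_disk hx) (ofReal_mem_disk hy) this
  rcases hc.strictMonoOn_of_injOn_Ioo (by norm_num) hi with h | h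
  · exact h
  · exfalso
    have hd : HasDerivAt (fun x : ℝ => (ψ x).re) (deriv ψ 0).re 0 := by
      have h0 : HasDerivAt ψ (((deriv ψ 0).re : ℝ) : ℂ) ((0 : ℝ) : ℂ) := by
        simpa using hψ.hasDerivAt_zero
      simpa using h0.real_of_complex
    have hev := hd.tendsto_slope.eventually (lt_mem_nhds hψ.deriv_re_pos)
    have hev' : ∀ᶠ x in 𝓝[>] (0 : ℝ), 0 < slope (fun x : ℝ => (ψ x).re) 0 x :=
      hev.filter_mono (nhdsWithin_mono _ fun x hx => ne_of_gt hx)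
    obtain ⟨x, hx1, hx2⟩ := (hev'.and (Ioo_mem_nhdsGT (zero_lt_one' ℝ))).exists
    have h3 := h ⟨by norm_num, by norm_num⟩ ⟨by linarith [hx2.1], hx2.2⟩ hx2.1
    rw [slope_def_field, sub_zero] at hx1
    have h4 := (div_pos_iff_of_pos_right hx2.1).mp hx1
    linarith

/-- By univalence and symmetry ψ is real only on the real diameter, so Im ψ has one sign on the
connected upper half-disk. The derivative at 0 along the imaginary axis shows that the sign is
positive. -/
theorem im_pos (hψ : IsMaMinda ψ) {z : ℂ} (hz : z ∈ disk) (him : 0 < z.im) : 0 < (ψ z).im := by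
  set U : Set ℂ := disk ∩ {z | 0 < z.im}
  have hU : IsPreconnected U := ((convex_ball _ _).inter (convex_halfSpace_im_gt 0)).isPreconnected
  have hc : ContinuousOn (fun z => (ψ z).im) U :=
    Complex.continuous_im.comp_continuousOn (hψ.analytic.continuousOn.mono inter_subset_left)
  obtain ⟨u, hu, hup⟩ : ∃ u ∈ U, 0 < (ψ u).im := by
    have hd : HasDerivAt (fun t : ℝ => (ψ (t * I)).im) (deriv ψ 0).re 0 := by
      have h0 : HasDerivAt ψ (((deriv ψ 0).re : ℝ) : ℂ) (((0 : ℝ) : ℂ) * I) := by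
        simpa using hψ.hasDerivAt_zero
      have h1 : HasDerivAt (fun t : ℝ => (t : ℂ) * I) (1 * I) 0 :=
        (Complex.ofRealCLM.hasDerivAt (x := (0 : ℝ))).mul_const I
      have h2 := HasDerivAt.comp (0 : ℝ) h0 h1
      have h3 := (Complex.imCLM.hasFDerivAt.comp_hasDerivAt (0 : ℝ) h2)
      have h4 : (Complex.imCLM ((((deriv ψ 0).re : ℝ) : ℂ) * (1 * I))) = (deriv ψ 0).re := by simp
      rw [h4] at h3
      exact h3
    have hev := hd.tendsto_slope.eventually (lt_mem_nhds hψ.deriv_re_pos)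
    have hev' : ∀ᶠ x in 𝓝[>] (0 : ℝ), 0 < slope (fun t : ℝ => (ψ (t * I)).im) 0 x :=
      hev.filter_mono (nhdsWithin_mono _ fun x hx => ne_of_gt hx)
    obtain ⟨x, hx1, hx2⟩ := (hev'.and (Ioo_mem_nhdsGT (zero_lt_one' ℝ))).exists
    refine ⟨x * I, ⟨?_, by simpa using hx2.1⟩, ?_⟩
    · simpa [mem_disk_iff, abs_of_pos hx2.1] using hx2.2
    · rw [slope_def_field, sub_zero] at hx1
      simpa [hψ.map_zero] using (div_pos_iff_of_pos_right hx2.1).mp hx1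
  by_contra hneg
  obtain ⟨y, hy, hy0⟩ := hU.intermediate_value (a := z) (b := u) ⟨hz, him⟩ hu hc
    (show (0 : ℝ) ∈ Icc _ _ from ⟨not_lt.mp hneg, hup.le⟩)
  exact hy.2.ne' (hψ.im_eq_zero_of_im_eq_zero hy.1 hy0)

theorem im_mul_im_nonneg (hψ : IsMaMinda ψ) {z : ℂ} (hz : z ∈ disk) : 0 ≤ z.im * (ψ z).im := by
  rcases lt_trichotomy z.im 0 with h | h | h
  · have h1 := hψ.im_pos (conj_mem_disk hz) (by simpa using h)
    rw [hψ.map_conj hz, Complex.conj_im] at h1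
    nlinarith
  · simp [h]
  · exact (mul_pos h (hψ.im_pos hz h)).le

end IsMaMinda

end

/-! ### The representation z exp H(z), univalence, and the extremal function. -/

section

/-- The representation `f(z) = z exp H(z)` with `z H'(z) = ψ(w(z)) - 1` for a Schwarz function `w`. -/
structure IsLogRep (ψ f w H : ℂ → ℂ) : Prop where
  schwarz_diff : DifferentiableOn ℂ w disk
  schwarz_maps : MapsTo w disk disk
  schwarz_zero : w 0 = 0
  log_diff : DifferentiableOn ℂ H disk
  log_zero : H 0 = 0
  log_deriv : ∀ z ∈ disk, z * deriv H z = ψ (w z) - 1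
  eq_mul_exp : ∀ z ∈ disk, f z = z * Complex.exp (H z)

theorem differentiableOn_dslope_zero {S : ℂ → ℂ} (hS : DifferentiableOn ℂ S disk) :
    DifferentiableOn ℂ (dslope S 0) disk :=
  (Complex.differentiableOn_dslope (isOpen_disk.mem_nhds zero_mem_disk)).mpr hS

theorem exists_log_primitive {S : ℂ → ℂ} (hS : DifferentiableOn ℂ S disk) (h0 : S 0 = 1) :
    ∃ H : ℂ → ℂ, H 0 = 0 ∧ (∀ z ∈ disk, HasDerivAt H (dslope S 0 z) z) ∧
      DifferentiableOn ℂ H disk ∧ ∀ z ∈ disk, z * deriv H z = S z - 1 := by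
  obtain ⟨H, hH0, hH⟩ := (differentiableOn_dslope_zero hS).isExactOn_ball.with_val_at 0 0
  refine ⟨H, hH0, hH, fun z hz => (hH z hz).differentiableAt.differentiableWithinAt, ?_⟩
  intro z hz
  rw [(hH z hz).deriv, self_eq_add_mul_dslope S z, h0]; ring

/-- A solution of `z u' = u` in the disk is linear. -/
theorem eq_deriv_mul_of_mul_deriv_eq {u : ℂ → ℂ} (hu : DifferentiableOn ℂ u disk)
    (h : ∀ z ∈ disk, z * deriv u z = u z) {z : ℂ} (hz : z ∈ disk) : u z = deriv u 0 * z := by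
  have hua := analyticAt_zero hu
  have h1 : X * taylorPS (deriv u) = taylorPS u := by
    rw [← taylorPS_id, ← taylorPS_mul (f := fun z => z) analyticAt_id hua.deriv]
    refine taylorPS_congr ?_
    filter_upwards [isOpen_disk.mem_nhds zero_mem_disk] with z hz using h z hz
  have h2 : ∀ n, n ≠ 1 → taylorCoeff u n = 0 := by
    intro n hn
    cases n with
    | zero => simpa using (h 0 zero_mem_disk).symm
    | succ n =>
      have := congrArg (coeff (n + 1)) h1
      rw [coeff_succ_X_mul, coeff_taylorPS, coeff_taylorPS, taylorCoeff_deriv] at this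
      have h3 : (n : ℂ) * taylorCoeff u (n + 1) = 0 := by linear_combination this
      refine (mul_eq_zero.mp h3).resolve_left ?_
      have : n ≠ 0 := by omega
      exact_mod_cast this
  have h3 := hasSum_taylorCoeff hu hz
  have h4 := hasSum_single (f := fun n => taylorCoeff u n * z ^ n) 1 (fun n hn => by simp [h2 n hn])
  rw [h3.unique h4, taylorCoeff_one, pow_one]

/-- With z H' = ψ(w) - 1, the function u = f exp(-H) satisfies z u' = u. Hence u is linear, and its
slope is f'(0) = 1. -/
theorem exists_isLogRep {ψ f : ℂ → ℂ} (hψ : IsMaMinda ψ) (hf : f ∈ starClass ψ) :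
    ∃ w H, IsLogRep ψ f w H := by
  obtain ⟨hn, hne, w, hw, hwm, hw0, hwe⟩ := hf
  have hS : DifferentiableOn ℂ (fun z => ψ (w z)) disk := hψ.analytic.comp hw hwm
  obtain ⟨H, hH0, -, hHd, hHe⟩ := exists_log_primitive hS (by simp [hw0, hψ.map_zero])
  refine ⟨w, H, hw, hwm, hw0, hHd, hH0, hHe, ?_⟩
  have hfd : ∀ z ∈ disk, HasDerivAt f (deriv f z) z := fun z hz =>
    (hn.analytic.differentiableAt (isOpen_disk.mem_nhds hz)).hasDerivAt
  have hHd' : ∀ z ∈ disk, HasDerivAt H (deriv H z) z := fun z hz =>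
    (hHd.differentiableAt (isOpen_disk.mem_nhds hz)).hasDerivAt
  have hfe : ∀ z ∈ disk, z * deriv f z = ψ (w z) * f z := by
    intro z hz
    rcases eq_or_ne z 0 with rfl | h0
    · simp [hn.map_zero]
    · have := hwe z hz
      rw [starQuotient, Function.update_of_ne h0] at this
      rw [← this, div_mul_cancel₀ _ (hne z hz h0)]
  have hud : ∀ z ∈ disk, HasDerivAt (fun z => f z * Complex.exp (-H z))
      (deriv f z * Complex.exp (-H z) + f z * (Complex.exp (-H z) * -deriv H z)) z := fun z hz =>
    (hfd z hz).mul (hHd' z hz).neg.cexp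
  have hlin : ∀ z ∈ disk, f z * Complex.exp (-H z) =
      deriv (fun z => f z * Complex.exp (-H z)) 0 * z := fun z hz =>
    eq_deriv_mul_of_mul_deriv_eq (u := fun z => f z * Complex.exp (-H z))
      (fun z hz => (hud z hz).differentiableAt.differentiableWithinAt) (fun z hz => by
        rw [(hud z hz).deriv]
        linear_combination Complex.exp (-H z) * hfe z hz - f z * Complex.exp (-H z) * hHe z hz) hz
  intro z hz
  have h1 := hlin z hz
  rw [(hud 0 zero_mem_disk).deriv, hn.map_zero, hn.deriv_zero, hH0] at h1
  simp only [neg_zero, Complex.exp_zero, mul_one, zero_mul, add_zero, one_mul] at h1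
  rw [Complex.exp_neg, mul_inv_eq_iff_eq_mul₀ (Complex.exp_ne_zero _)] at h1
  exact h1

namespace IsLogRep

variable {ψ f w H : ℂ → ℂ}

theorem log_hasDerivAt (h : IsLogRep ψ f w H) {z : ℂ} (hz : z ∈ disk) :
    HasDerivAt H (deriv H z) z :=
  (h.log_diff.differentiableAt (isOpen_disk.mem_nhds hz)).hasDerivAt

theorem norm_schwarz_le (h : IsLogRep ψ f w H) {z : ℂ} (hz : z ∈ disk) : ‖w z‖ ≤ ‖z‖ :=
  norm_le_norm_of_mapsTo_ball h.schwarz_diff (fun _ hx => ball_subset_closedBall (h.schwarz_maps hx))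
    h.schwarz_zero (mem_disk_iff.mp hz)

theorem hasDerivAt (h : IsLogRep ψ f w H) {z : ℂ} (hz : z ∈ disk) :
    HasDerivAt f (ψ (w z) * Complex.exp (H z)) z := by
  have h1 : HasDerivAt (fun z => z * Complex.exp (H z))
      (1 * Complex.exp (H z) + z * (Complex.exp (H z) * deriv H z)) z :=
    (hasDerivAt_id' z).mul (h.log_hasDerivAt hz).cexp
  have h2 : f =ᶠ[𝓝 z] fun z => z * Complex.exp (H z) := by
    filter_upwards [isOpen_disk.mem_nhds hz] with x hx using h.eq_mul_exp x hx
  convert! h1.congr_of_eventuallyEq h2 using 1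
  linear_combination -Complex.exp (H z) * h.log_deriv z hz

theorem differentiableOn (h : IsLogRep ψ f w H) : DifferentiableOn ℂ f disk :=
  fun _ hz => (h.hasDerivAt hz).differentiableAt.differentiableWithinAt

theorem map_zero (h : IsLogRep ψ f w H) : f 0 = 0 := by
  simp [h.eq_mul_exp 0 zero_mem_disk]

theorem ne_zero (h : IsLogRep ψ f w H) {z : ℂ} (hz : z ∈ disk) (h0 : z ≠ 0) : f z ≠ 0 := by
  rw [h.eq_mul_exp z hz]
  exact mul_ne_zero h0 (Complex.exp_ne_zero _)

theorem deriv_zero (hψ : IsMaMinda ψ) (h : IsLogRep ψ f w H) : deriv f 0 = 1 := by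
  rw [(h.hasDerivAt zero_mem_disk).deriv, h.schwarz_zero, hψ.map_zero, h.log_zero]; simp

theorem mem_starClass (hψ : IsMaMinda ψ) (h : IsLogRep ψ f w H) : f ∈ starClass ψ := by
  refine ⟨⟨h.differentiableOn, h.map_zero, h.deriv_zero hψ⟩, fun z hz h0 => h.ne_zero hz h0, w,
    h.schwarz_diff, h.schwarz_maps, h.schwarz_zero, fun z hz => ?_⟩
  rcases eq_or_ne z 0 with rfl | h0
  · simp [starQuotient, h.schwarz_zero, hψ.map_zero]
  · rw [starQuotient, Function.update_of_ne h0, (h.hasDerivAt hz).deriv, div_eq_iff (h.ne_zero hz h0),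
      h.eq_mul_exp z hz]
    ring

end IsLogRep

/-- A function whose derivative has positive real part on a convex set is injective there. -/
theorem injOn_of_re_deriv_pos {φ φ' : ℂ → ℂ} {s : Set ℂ} (hs : Convex ℝ s)
    (hd : ∀ z ∈ s, HasDerivAt φ (φ' z) z) (hp : ∀ z ∈ s, 0 < (φ' z).re) : InjOn φ s := by
  intro a ha b hb hab
  by_contra hne
  have hba : b - a ≠ 0 := sub_ne_zero.mpr (Ne.symm hne)
  have hmem : ∀ t ∈ Icc (0 : ℝ) 1, a + t * (b - a) ∈ s := by
    intro t ht
    have := hs.add_smul_sub_mem ha hb ht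
    simpa using this
  -- Noshiro–Warschawski: along the segment the real part of φ / (b - a) has derivative Re φ' > 0,
  -- so its endpoint values cannot agree.
  have hg : ∀ t ∈ Icc (0 : ℝ) 1,
      HasDerivAt (fun t : ℝ => (φ (a + t * (b - a)) / (b - a)).re) (φ' (a + t * (b - a))).re t := by
    intro t ht
    have h1 : HasDerivAt (fun t : ℝ => a + (t : ℂ) * (b - a)) (1 * (b - a)) t :=
      ((Complex.ofRealCLM.hasDerivAt (x := t)).mul_const (b - a)).const_add a
    have h2 := (HasDerivAt.comp t (hd _ (hmem t ht)) h1).div_const (b - a)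
    have h3 := Complex.reCLM.hasFDerivAt.comp_hasDerivAt t h2
    have h4 : Complex.reCLM (φ' (a + t * (b - a)) * (1 * (b - a)) / (b - a)) =
        (φ' (a + t * (b - a))).re := by
      rw [one_mul, mul_div_cancel_right₀ _ hba]; rfl
    rw [h4] at h3
    exact h3
  obtain ⟨t, ht, hte⟩ := exists_hasDerivAt_eq_slope _ _ (zero_lt_one' ℝ)
    (fun t ht => (hg t ht).continuousAt.continuousWithinAt) (fun t ht => hg t (Ioo_subset_Icc_self ht))
  have h5 := hp _ (hmem t (Ioo_subset_Icc_self ht))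
  rw [hte] at h5
  simp [hab] at h5

/-- Functions of the class are univalent. -/
theorem IsLogRep.injOn {ψ f w H : ℂ → ℂ} (hψ : IsMaMinda ψ) (h : IsLogRep ψ f w H) :
    InjOn f disk := by
  have hexp : ∀ ζ : ℂ, ζ.re < 0 → Complex.exp ζ ∈ disk := by
    intro ζ hζ
    rw [mem_disk_iff, Complex.norm_exp, Real.exp_lt_one_iff]
    exact hζ
  -- In the coordinate z = exp ζ one has f = exp(ζ + H(exp ζ)), and this exponent has derivative
  -- ψ(w(exp ζ)), of positive real part.
  have hinj : InjOn (fun ζ : ℂ => ζ + H (Complex.exp ζ)) {ζ | ζ.re < 0} := by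
    refine injOn_of_re_deriv_pos (φ' := fun ζ => ψ (w (Complex.exp ζ))) (convex_halfSpace_re_lt 0) ?_
      (fun ζ hζ => hψ.re_pos _ (h.schwarz_maps (hexp ζ hζ)))
    intro ζ hζ
    have h1 := (hasDerivAt_id' ζ).add
      ((h.log_hasDerivAt (hexp ζ hζ)).comp ζ (Complex.hasDerivAt_exp ζ))
    convert! h1 using 1
    linear_combination -h.log_deriv _ (hexp ζ hζ)
  have hlog : ∀ z ∈ disk, z ≠ 0 → (Complex.log z).re < 0 := by
    intro z hz h0
    rw [Complex.log_re]
    exact Real.log_neg (norm_pos_iff.mpr h0) (mem_disk_iff.mp hz)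
  intro a ha b hb hab
  rcases eq_or_ne a 0 with rfl | ha0
  · by_contra hb0
    exact h.ne_zero hb (Ne.symm hb0) (by rw [← hab, h.map_zero])
  rcases eq_or_ne b 0 with rfl | hb0
  · exact absurd (by rw [hab, h.map_zero]) (h.ne_zero ha ha0)
  have hea := Complex.exp_log ha0
  have heb := Complex.exp_log hb0
  have h1 : Complex.exp (Complex.log a + H a) = Complex.exp (Complex.log b + H b) := by
    rw [Complex.exp_add, Complex.exp_add, hea, heb, ← h.eq_mul_exp a ha, ← h.eq_mul_exp b hb, hab]
  -- The multiple of 2πi is absorbed by shifting log b, which stays in the left half-plane and still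
  -- maps to b.
  obtain ⟨n, hn⟩ := Complex.exp_eq_exp_iff_exists_int.mp h1
  have hper : Complex.exp (Complex.log b + n * (2 * Real.pi * I)) = b := by
    rw [Complex.exp_add, heb, Complex.exp_int_mul_two_pi_mul_I, mul_one]
  have hre : (Complex.log b + n * (2 * Real.pi * I)).re < 0 := by
    have : (Complex.log b + n * (2 * Real.pi * I)).re = (Complex.log b).re := by simp
    rw [this]; exact hlog b hb hb0
  have h2 := hinj (hlog a ha ha0) hre (by
    simp only [hper, hea]
    rw [hn]; ring)
  rw [← hea, h2, hper]

/-- `h` is the logarithm of `f₀(z) / z`, where `f₀` is the extremal function. -/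
structure IsExtremalLog (ψ h : ℂ → ℂ) : Prop where
  rep : IsLogRep ψ (extremal ψ) (fun z => z) h
  hasDerivAt : ∀ z ∈ disk, HasDerivAt h (dslope ψ 0 z) z

theorem exists_isExtremalLog {ψ : ℂ → ℂ} (hψ : IsMaMinda ψ) : ∃ h, IsExtremalLog ψ h := by
  obtain ⟨h, h0, hd, hdiff, hde⟩ := exists_log_primitive hψ.analytic hψ.map_zero
  refine ⟨h, ⟨differentiableOn_id, fun z hz => hz, rfl, hdiff, h0, hde, fun z hz => ?_⟩, hd⟩
  have hmem : ∀ s ∈ Icc (0 : ℝ) 1, (s : ℂ) * z ∈ disk := by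
    intro s hs
    rw [mem_disk_iff, norm_mul, Complex.norm_real, Real.norm_of_nonneg hs.1]
    exact lt_of_le_of_lt (mul_le_of_le_one_left (norm_nonneg _) hs.2) (mem_disk_iff.mp hz)
  have huIcc : uIcc (0 : ℝ) 1 = Icc 0 1 := uIcc_of_le zero_le_one
  have hintegral : ∫ s in (0 : ℝ)..1, dslope ψ 0 (s * z) * z = h z := by
    have hder : ∀ s ∈ uIcc (0 : ℝ) 1,
        HasDerivAt (fun s : ℝ => h (s * z)) (dslope ψ 0 (s * z) * z) s := by
      intro s hs
      rw [huIcc] at hs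
      have h1 : HasDerivAt (fun s : ℝ => (s : ℂ) * z) (1 * z) s :=
        (Complex.ofRealCLM.hasDerivAt (x := s)).mul_const z
      simpa using! HasDerivAt.comp s (hd _ (hmem s hs)) h1
    rw [intervalIntegral.integral_eq_sub_of_hasDerivAt hder]
    · simp [h0]
    · refine ContinuousOn.intervalIntegrable ?_
      rw [huIcc]
      refine ContinuousOn.mul ?_ continuousOn_const
      exact (differentiableOn_dslope_zero hψ.analytic).continuousOn.comp (by fun_prop) hmem
  rw [extremal, ← hintegral]
  congr 2
  -- The quotient and `dslope` can differ only at s = 0, which the half-open interval of integration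
  -- excludes.
  refine intervalIntegral.integral_congr_ae (Eventually.of_forall fun s hs => ?_)
  rw [uIoc_of_le zero_le_one] at hs
  rcases eq_or_ne z 0 with rfl | hz0
  · simp
  · have hsz : (s : ℂ) * z ≠ 0 := mul_ne_zero (by exact_mod_cast hs.1.ne') hz0
    congr 1
    rw [dslope_of_ne _ hsz, slope_def_field, hψ.map_zero, sub_zero]

theorem IsExtremalLog.map_conj {ψ h : ℂ → ℂ} (hψ : IsMaMinda ψ) (hh : IsExtremalLog ψ h) {z : ℂ}
    (hz : z ∈ disk) : h ((starRingEnd ℂ) z) = (starRingEnd ℂ) (h z) := by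
  have hd : ∀ x ∈ disk, HasDerivAt (fun x => ((starRingEnd ℂ) ∘ h ∘ (starRingEnd ℂ)) x - h x) 0 x := by
    intro x hx
    have h1 := (hh.hasDerivAt _ (conj_mem_disk hx)).conj_conj
    rw [Complex.conj_conj] at h1
    convert! h1.sub (hh.hasDerivAt x hx) using 1
    symm
    rw [sub_eq_zero]
    rcases eq_or_ne x 0 with rfl | hx0
    · simpa using Complex.conj_eq_iff_im.mpr hψ.deriv_im
    · have hx1 : (starRingEnd ℂ) x ≠ 0 := by simpa using hx0
      rw [dslope_of_ne _ hx0, dslope_of_ne _ hx1, slope_def_field, slope_def_field, hψ.map_conj hx]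
      simp [hψ.map_zero]
  have h2 := isOpen_disk.is_const_of_deriv_eq_zero isPreconnected_disk
    (fun x hx => (hd x hx).differentiableAt.differentiableWithinAt) (fun x hx => (hd x hx).deriv)
    (conj_mem_disk hz) zero_mem_disk
  simp only [Function.comp_apply, Complex.conj_conj, map_zero, hh.rep.log_zero, sub_zero] at h2
  exact (sub_eq_zero.mp h2).symm

end

/-! ### The growth theorem, the Koebe radius and the boundary distance. -/

section

variable {ψ f w H h : ℂ → ℂ}

theorem neg_ofReal_mem_disk {r : ℝ} (h0 : 0 ≤ r) (h1 : r < 1) : (-(r : ℂ)) ∈ disk := by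
  rw [mem_disk_iff, norm_neg, Complex.norm_real, Real.norm_of_nonneg h0]
  exact h1

theorem hasDerivAt_log_radial (hh : IsLogRep ψ f w H) {z : ℂ} {t : ℝ} (hz : (t : ℂ) * z ∈ disk) :
    HasDerivAt (fun t : ℝ => (H (t * z)).re) (deriv H (t * z) * z).re t := by
  have h1 : HasDerivAt (fun s : ℝ => (s : ℂ) * z) (1 * z) t :=
    (Complex.ofRealCLM.hasDerivAt (x := t)).mul_const z
  have h2 := HasDerivAt.comp t (hh.log_hasDerivAt hz) h1
  have h3 := Complex.reCLM.hasFDerivAt.comp_hasDerivAt t h2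
  rw [one_mul] at h3
  exact h3

/-- The growth theorem: `|f(z)|` is at least `|f₀(-|z|)|`. -/
theorem re_log_extremal_le (hψ : IsMaMinda ψ) (hh : IsExtremalLog ψ h) (hf : IsLogRep ψ f w H)
    {z : ℂ} (hz : z ∈ disk) : (h (-(‖z‖ : ℂ))).re ≤ (H z).re := by
  have hR := mem_disk_iff.mp hz
  have hsub : closedBall (0 : ℂ) ‖z‖ ⊆ disk := closedBall_subset_ball hR
  -- It is not assumed that Re ψ is smallest at -r on each circle |x| = r, so the radial derivative
  -- is compared only at a minimum point of U. The term ε‖x‖ makes that derivative strictly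
  -- positive.
  have key : ∀ ε : ℝ, 0 < ε → 0 ≤ (H z).re - (h (-(‖z‖ : ℂ))).re + ε * ‖z‖ := by
    intro ε hε
    set U : ℂ → ℝ := fun x => (H x).re - (h (-(‖x‖ : ℂ))).re + ε * ‖x‖ with hU
    have hUc : ContinuousOn U (closedBall 0 ‖z‖) := by
      refine ContinuousOn.add (ContinuousOn.sub ?_ ?_) (by fun_prop)
      · exact Complex.continuous_re.comp_continuousOn (hf.log_diff.continuousOn.mono hsub)
      · refine Complex.continuous_re.comp_continuousOn
          (hh.rep.log_diff.continuousOn.comp (by fun_prop) ?_)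
        intro x hx
        exact neg_ofReal_mem_disk (norm_nonneg _) (mem_disk_iff.mp (hsub hx))
    obtain ⟨a, ha, hmin⟩ := (isCompact_closedBall (0 : ℂ) ‖z‖).exists_isMinOn
      ⟨0, by simp⟩ hUc
    suffices h0 : 0 ≤ U a from h0.trans (hmin (by simp))
    rcases eq_or_ne a 0 with rfl | ha0
    · simp [hU, hf.log_zero, hh.rep.log_zero]
    exfalso
    have had := hsub ha
    have hapos : 0 < ‖a‖ := norm_pos_iff.mpr ha0
    -- the angular derivative vanishes at the minimum
    have hang : (ψ (w a)).im = 0 := by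
      have h1 : HasDerivAt (fun θ : ℝ => a * Complex.exp (θ * I)) (a * I) 0 := by
        have h2 : HasDerivAt (fun θ : ℝ => (θ : ℂ) * I) (1 * I) 0 :=
          (Complex.ofRealCLM.hasDerivAt (x := (0 : ℝ))).mul_const I
        simpa using! h2.cexp.const_mul a
      have h0 : a * Complex.exp ((0 : ℝ) * I) = a := by simp
      have h2 : HasDerivAt (fun θ : ℝ => H (a * Complex.exp (θ * I))) (deriv H a * (a * I)) 0 := by
        refine HasDerivAt.comp (0 : ℝ) ?_ h1
        rw [h0]; exact hf.log_hasDerivAt had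
      have h3 := Complex.reCLM.hasFDerivAt.comp_hasDerivAt (0 : ℝ) h2
      have h4 : IsLocalMin (Complex.reCLM ∘ fun θ : ℝ => H (a * Complex.exp (θ * I))) 0 := by
        refine Eventually.of_forall fun θ => ?_
        have hn : ‖a * Complex.exp (θ * I)‖ = ‖a‖ := by
          rw [norm_mul, Complex.norm_exp_ofReal_mul_I, mul_one]
        have h5 : U a ≤ U (a * Complex.exp (θ * I)) := hmin (by simpa [hn] using ha)
        simp only [hU, hn] at h5
        simp only [Function.comp_apply, h0, Complex.reCLM_apply]
        linarith
      have h5 := h4.hasDerivAt_eq_zero h3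
      have h6 : deriv H a * (a * I) = (ψ (w a) - 1) * I := by
        rw [← hf.log_deriv a had]; ring
      rw [h6] at h5
      simpa using h5
    have hwr : (w a).im = 0 := hψ.im_eq_zero_of_im_eq_zero (hf.schwarz_maps had) hang
    have hwa : w a = (((w a).re : ℝ) : ℂ) := Complex.ext (by simp) (by simp [hwr])
    have hwn : |(w a).re| ≤ ‖a‖ := (Complex.abs_re_le_norm _).trans (hf.norm_schwarz_le had)
    have ha1 := mem_disk_iff.mp had
    -- At the minimum w(a) is real, and it is at least -‖a‖ by the Schwarz lemma, so monotonicity of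
    -- ψ on the diameter applies.
    have hmono : (ψ (-(‖a‖ : ℂ))).re ≤ (ψ (w a)).re := by
      have := hψ.strictMonoOn.monotoneOn (a := -‖a‖) (b := (w a).re) ⟨by linarith, by linarith⟩
        ⟨by linarith [(abs_le.mp hwn).1], by linarith [(abs_le.mp hwn).2]⟩ (abs_le.mp hwn).1
      rw [hwa]
      simpa using this
    have hrad : HasDerivAt (fun t : ℝ => (H (t * a)).re - (h (t * (-(‖a‖ : ℂ)))).re + ε * (t * ‖a‖))
        ((deriv H ((1 : ℝ) * a) * a).re -
          (deriv h ((1 : ℝ) * (-(‖a‖ : ℂ))) * (-(‖a‖ : ℂ))).re + ε * (1 * ‖a‖)) 1 := by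
      refine ((hasDerivAt_log_radial hf (by simpa using had)).sub
        (hasDerivAt_log_radial hh.rep ?_)).add (((hasDerivAt_id' (1 : ℝ)).mul_const _).const_mul _)
      simpa using neg_ofReal_mem_disk (norm_nonneg a) ha1
    have hval : 0 < (deriv H ((1 : ℝ) * a) * a).re -
          (deriv h ((1 : ℝ) * (-(‖a‖ : ℂ))) * (-(‖a‖ : ℂ))).re + ε * (1 * ‖a‖) := by
      have e1 : deriv H ((1 : ℝ) * a) * a = ψ (w a) - 1 := by
        rw [← hf.log_deriv a had]; simp [mul_comm]
      have e2 : deriv h ((1 : ℝ) * (-(‖a‖ : ℂ))) * (-(‖a‖ : ℂ)) = ψ (-(‖a‖ : ℂ)) - 1 := by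
        rw [← hh.rep.log_deriv _ (neg_ofReal_mem_disk (norm_nonneg a) ha1)]; simp [mul_comm]
      rw [e1, e2]
      have := mul_pos hε hapos
      simp only [sub_re]
      linarith
    have hev : ∀ᶠ t in 𝓝[<] (1 : ℝ), 0 < slope
        (fun t : ℝ => (H (t * a)).re - (h (t * (-(‖a‖ : ℂ)))).re + ε * (t * ‖a‖)) 1 t :=
      (hrad.tendsto_slope.eventually (lt_mem_nhds hval)).filter_mono
        (nhdsWithin_mono _ fun x hx => ne_of_lt hx)
    -- A positive radial derivative makes U smaller at t a for some t < 1, against minimality.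
    obtain ⟨t, ht1, ht2⟩ := (hev.and (Ioo_mem_nhdsLT (zero_lt_one' ℝ))).exists
    have hn : ‖(t : ℂ) * a‖ = t * ‖a‖ := by
      rw [norm_mul, Complex.norm_real, Real.norm_of_nonneg ht2.1.le]
    have hta : U a ≤ U (t * a) := by
      refine hmin ?_
      have haz : ‖a‖ ≤ ‖z‖ := by simpa using ha
      have : ‖(t : ℂ) * a‖ ≤ ‖z‖ := by
        rw [hn]; nlinarith [ht2.2]
      simpa using this
    rw [slope_def_field] at ht1
    have h7 : t - 1 < 0 := by linarith [ht2.2]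
    have h8 := (div_pos_iff.mp ht1).resolve_left (fun h => by linarith [h.2])
    have h9 := h8.1
    simp only [hU, hn] at hta
    simp only [Complex.ofReal_one, one_mul] at h9
    have h10 : (t : ℂ) * -(‖a‖ : ℂ) = -((t * ‖a‖ : ℝ) : ℂ) := by push_cast; ring
    rw [h10] at h9
    linarith
  have hlim : Tendsto (fun ε : ℝ => (H z).re - (h (-(‖z‖ : ℂ))).re + ε * ‖z‖) (𝓝[>] 0)
      (𝓝 ((H z).re - (h (-(‖z‖ : ℂ))).re + 0 * ‖z‖)) :=
    (Continuous.tendsto (by fun_prop) 0).mono_left nhdsWithin_le_nhds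
  have := ge_of_tendsto hlim (eventually_mem_nhdsWithin.mono fun ε hε => key ε hε)
  linarith

/-- The modulus `|f₀(-r)|` of the extremal function on the negative radius. -/
noncomputable def radialMod (h : ℂ → ℂ) (r : ℝ) : ℝ := r * Real.exp (h (-(r : ℂ))).re

theorem strictMonoOn_radialMod (hψ : IsMaMinda ψ) (hh : IsExtremalLog ψ h) :
    StrictMonoOn (radialMod h) (Ico 0 1) := by
  have hd : ∀ r ∈ Ico (0 : ℝ) 1, HasDerivAt (radialMod h)
      (Real.exp (h (-(r : ℂ))).re * (ψ (-(r : ℂ))).re) r := by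
    intro r hr
    have hm := neg_ofReal_mem_disk hr.1 hr.2
    have h1 := hasDerivAt_log_radial hh.rep (z := -1) (t := r) (by simpa using hm)
    simp only [mul_neg, mul_one] at h1
    have h2 := (hasDerivAt_id' r).mul h1.exp
    convert! h2 using 1
    have h3 := congrArg re (hh.rep.log_deriv _ hm)
    simp at h3
    simp
    linear_combination -Real.exp (h (-(r : ℂ))).re * h3
  refine strictMonoOn_of_deriv_pos (convex_Ico 0 1)
    (fun r hr => (hd r hr).continuousAt.continuousWithinAt) ?_
  intro r hr
  rw [interior_Ico] at hr
  have hr' := Ioo_subset_Ico_self hr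
  rw [(hd r hr').deriv]
  exact mul_pos (Real.exp_pos _) (hψ.re_pos _ (neg_ofReal_mem_disk hr'.1 hr'.2))

/-- The growth theorem applied to the identity map shows that `radialMod` is bounded by 1, so its
supremum is meaningful. -/
theorem isLogRep_id (hψ : IsMaMinda ψ) : IsLogRep ψ (fun z => z) (fun _ => 0) (fun _ => 0) where
  schwarz_diff := differentiableOn_const _
  schwarz_maps := fun _ _ => zero_mem_disk
  schwarz_zero := rfl
  log_diff := differentiableOn_const _
  log_zero := rfl
  log_deriv := fun z _ => by simp [hψ.map_zero]
  eq_mul_exp := fun z _ => by simp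

theorem radialMod_le_norm (hψ : IsMaMinda ψ) (hh : IsExtremalLog ψ h) (hf : IsLogRep ψ f w H)
    {z : ℂ} (hz : z ∈ disk) : radialMod h ‖z‖ ≤ ‖f z‖ := by
  rw [hf.eq_mul_exp z hz, norm_mul, Complex.norm_exp, radialMod]
  exact mul_le_mul_of_nonneg_left (Real.exp_le_exp.mpr (re_log_extremal_le hψ hh hf hz))
    (norm_nonneg _)

theorem radialMod_le_one (hψ : IsMaMinda ψ) (hh : IsExtremalLog ψ h) {r : ℝ} (hr : r ∈ Ico
    (0 : ℝ) 1) :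
    radialMod h r ≤ 1 := by
  have hm : (r : ℂ) ∈ disk := IsMaMinda.ofReal_mem_disk ⟨by linarith [hr.1], hr.2⟩
  have := radialMod_le_norm hψ hh (isLogRep_id hψ) hm
  rw [Complex.norm_real, Real.norm_of_nonneg hr.1] at this
  exact this.trans hr.2.le

/-- The image of |z| < r is open, and its limit points outside it come from |z| = r, where |f| is at
least `radialMod h r`. The connected ball therefore cannot leave the image. -/
theorem ball_radialMod_subset (hψ : IsMaMinda ψ) (hh : IsExtremalLog ψ h) (hf : IsLogRep ψ f w H)
    {r : ℝ} (hr : r ∈ Ioo (0 : ℝ) 1) : ball 0 (radialMod h r) ⊆ f '' disk := by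
  have hsub : closedBall (0 : ℂ) r ⊆ disk := closedBall_subset_ball hr.2
  have hpos : 0 < radialMod h r := mul_pos hr.1 (Real.exp_pos _)
  have hopen : IsOpen (f '' ball 0 r) :=
    isOpen_image_of_injOn hf.differentiableOn (hf.injOn hψ) (ball_subset_ball hr.2.le) isOpen_ball
  have h1 : ball 0 (radialMod h r) ⊆ f '' ball 0 r := by
    refine (convex_ball _ _).isPreconnected.subset_of_closure_inter_subset hopen
      ⟨0, mem_ball_self hpos, 0, mem_ball_self hr.1, hf.map_zero⟩ ?_
    rintro y ⟨hy1, hy2⟩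
    have hcl : closure (f '' ball 0 r) ⊆ f '' closedBall 0 r :=
      closure_minimal (image_mono ball_subset_closedBall) ((isCompact_closedBall _ _).image_of_continuousOn
        (hf.differentiableOn.continuousOn.mono hsub)).isClosed
    obtain ⟨x, hx, rfl⟩ := hcl hy1
    refine ⟨x, ?_, rfl⟩
    have hxr : ‖x‖ ≤ r := by simpa using hx
    rcases hxr.lt_or_eq with hlt | heq
    · simpa using hlt
    · have := radialMod_le_norm hψ hh hf (hsub hx)
      rw [heq] at this
      simp at hy2
      linarith
  exact h1.trans (image_mono (ball_subset_ball hr.2.le))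

/-- Needed because `infDist` to an empty frontier would be 0. If f were onto, compactness would put
the preimage of the closed unit disk inside |z| < r < 1. Then |z / f(z)| = |exp(-H)| ≤ r on |z| = r,
and the maximum principle contradicts the value 1 at the origin. -/
theorem image_disk_ne_univ (hψ : IsMaMinda ψ) (hf : IsLogRep ψ f w H) : f '' disk ≠ univ := by
  intro huniv
  have hi := hf.injOn hψ
  set η := Function.invFunOn f disk
  have hη : ∀ x ∈ disk, η (f x) = x := fun x hx => hi.leftInvOn_invFunOn hx
  have hsurj : ∀ y : ℂ, ∃ x ∈ disk, f x = y := fun y => by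
    have : y ∈ f '' disk := huniv ▸ mem_univ y
    exact this
  have hcont : Continuous η := continuous_iff_continuousAt.mpr fun y => by
    obtain ⟨x, hx, rfl⟩ := hsurj y
    exact continuousAt_invFunOn hf.differentiableOn hi hx
  obtain ⟨b, hb, hmax⟩ := (isCompact_closedBall (0 : ℂ) 1).exists_isMaxOn ⟨0, by simp⟩
    (hcont.norm.continuousOn)
  have hb1 : ‖η b‖ < 1 := by
    obtain ⟨x, hx, rfl⟩ := hsurj b
    rw [hη x hx]; exact mem_disk_iff.mp hx
  obtain ⟨r, hr1, hr2⟩ := exists_between hb1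
  have hr0 : 0 < r := (norm_nonneg _).trans_lt hr1
  have hsub : closedBall (0 : ℂ) r ⊆ disk := closedBall_subset_ball hr2
  have hbig : ∀ x ∈ sphere (0 : ℂ) r, 1 < ‖f x‖ := by
    intro x hx
    have hxd := hsub (sphere_subset_closedBall hx)
    by_contra hle
    have h1 : ‖η (f x)‖ ≤ ‖η b‖ := hmax (by simpa using hle)
    rw [hη x hxd] at h1
    have h2 : ‖x‖ = r := by simpa using hx
    linarith
  have h1 : ‖Complex.exp (-H 0)‖ ≤ r := by
    refine Complex.norm_le_of_forall_mem_frontier_norm_le (f := fun z => Complex.exp (-H z))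
      (isBounded_ball (x := (0 : ℂ)) (r := r))
      (DifferentiableOn.diffContOnCl_ball ((hf.log_diff.mono hsub).neg.cexp) subset_rfl) ?_
      (subset_closure (mem_ball_self hr0))
    intro x hx
    rw [frontier_ball _ hr0.ne'] at hx
    have hxd := hsub (sphere_subset_closedBall hx)
    have h2 : ‖x‖ = r := by simpa using hx
    have h3 := hbig x hx
    rw [hf.eq_mul_exp x hxd, norm_mul, h2] at h3
    rw [Complex.exp_neg, norm_inv, inv_le_iff_one_le_mul₀ (norm_pos_iff.mpr (Complex.exp_ne_zero _))]
    exact h3.le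
  rw [hf.log_zero] at h1
  simp at h1
  linarith

/-- The limit of `|f₀(-r)|` as `r → 1`. -/
noncomputable def radialSup (h : ℂ → ℂ) : ℝ := sSup (radialMod h '' Ico 0 1)

theorem radialMod_lt_radialSup (hψ : IsMaMinda ψ) (hh : IsExtremalLog ψ h) {r : ℝ}
    (hr : r ∈ Ico (0 : ℝ) 1) : radialMod h r < radialSup h := by
  have hr' : (r + 1) / 2 ∈ Ico (0 : ℝ) 1 := ⟨by linarith [hr.1], by linarith [hr.2]⟩
  refine (strictMonoOn_radialMod hψ hh hr hr' (by linarith [hr.2])).trans_le ?_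
  refine le_csSup ⟨1, ?_⟩ ⟨_, hr', rfl⟩
  rintro _ ⟨x, hx, rfl⟩
  exact radialMod_le_one hψ hh hx

theorem radialSup_pos (hψ : IsMaMinda ψ) (hh : IsExtremalLog ψ h) : 0 < radialSup h := by
  have := radialMod_lt_radialSup hψ hh (r := 0) ⟨le_rfl, one_pos⟩
  simpa [radialMod] using this

theorem exists_lt_radialMod {y : ℝ} (hy : y < radialSup h) :
    ∃ r ∈ Ico (0 : ℝ) 1, y < radialMod h r := by
  obtain ⟨_, ⟨r, hr, rfl⟩, hlt⟩ := exists_lt_of_lt_csSup (Nonempty.image _ ⟨0, by simp⟩) hy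
  exact ⟨r, hr, hlt⟩

theorem ball_radialSup_subset (hψ : IsMaMinda ψ) (hh : IsExtremalLog ψ h) (hf : IsLogRep ψ f w H) :
    ball 0 (radialSup h) ⊆ f '' disk := by
  intro y hy
  obtain ⟨r, hr, hlt⟩ := exists_lt_radialMod (mem_ball_zero_iff.mp hy)
  have hr0 : 0 < r := by
    rcases hr.1.lt_or_eq with h0 | h0
    · exact h0
    · rw [← h0] at hlt
      simp [radialMod] at hlt
      exact absurd hlt (not_lt.mpr (norm_nonneg y))
  exact ball_radialMod_subset hψ hh hf ⟨hr0, hr.2⟩ (mem_ball_zero_iff.mpr hlt)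

theorem extremal_neg_ofReal (hψ : IsMaMinda ψ) (hh : IsExtremalLog ψ h) {r : ℝ}
    (hr : r ∈ Ioo (-1 : ℝ) 1) : extremal ψ (-(r : ℂ)) = -((radialMod h r : ℝ) : ℂ) := by
  have hm : (-(r : ℂ)) ∈ disk := by
    have := IsMaMinda.ofReal_mem_disk (x := -r) ⟨by linarith [hr.2], by linarith [hr.1]⟩
    simpa using this
  have h1 := hh.map_conj hψ hm
  simp only [map_neg, Complex.conj_ofReal] at h1
  have h2 : h (-(r : ℂ)) = (((h (-(r : ℂ))).re : ℝ) : ℂ) :=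
    ((Complex.conj_eq_iff_real.mp h1.symm).choose_spec.symm ▸ by simp)
  rw [hh.rep.eq_mul_exp _ hm, h2, radialMod]
  push_cast
  simp

/-- A preimage of a real value is real, by symmetry and univalence. On the negative radius |f₀|
stays strictly below its supremum, and on the positive radius f₀ is positive. -/
theorem neg_radialSup_notMem (hψ : IsMaMinda ψ) (hh : IsExtremalLog ψ h) :
    -((radialSup h : ℝ) : ℂ) ∉ extremal ψ '' disk := by
  rintro ⟨z, hz, hze⟩
  have hconj : extremal ψ ((starRingEnd ℂ) z) = extremal ψ z := by
    have : extremal ψ ((starRingEnd ℂ) z) = (starRingEnd ℂ) (extremal ψ z) := by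
      rw [hh.rep.eq_mul_exp z hz, hh.rep.eq_mul_exp _ (conj_mem_disk hz), hh.map_conj hψ hz, map_mul,
        Complex.exp_conj]
    rw [this, hze]
    simp
  have hz2 := hh.rep.injOn hψ (conj_mem_disk hz) hz hconj
  obtain ⟨x, rfl⟩ := Complex.conj_eq_iff_real.mp hz2
  have hx : |x| < 1 := by simpa [mem_disk_iff] using hz
  obtain ⟨hx1, hx2⟩ := abs_lt.mp hx
  have h1 := extremal_neg_ofReal hψ hh (r := -x) ⟨by linarith, by linarith⟩
  rw [Complex.ofReal_neg, neg_neg, hze, neg_inj, Complex.ofReal_inj] at h1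
  rcases le_or_gt 0 (-x) with h0 | h0
  · exact (radialMod_lt_radialSup hψ hh ⟨h0, by linarith⟩).ne' h1
  · have := radialSup_pos hψ hh
    rw [h1, radialMod] at this
    nlinarith [Real.exp_pos (h (-((-x : ℝ) : ℂ))).re]

theorem koebeRadius_eq (hψ : IsMaMinda ψ) (hh : IsExtremalLog ψ h) :
    koebeRadius ψ = radialSup h := by
  refine IsGreatest.csSup_eq ⟨?_, ?_⟩
  · intro f hf
    obtain ⟨w, H, hrep⟩ := exists_isLogRep hψ hf
    exact ball_radialSup_subset hψ hh hrep
  · intro ρ hρ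
    by_contra hlt
    refine neg_radialSup_notMem hψ hh (hρ _ (hh.rep.mem_starClass hψ) ?_)
    simpa [abs_of_pos (radialSup_pos hψ hh)] using not_le.mp hlt

theorem radialSup_le_boundaryDist (hψ : IsMaMinda ψ) (hh : IsExtremalLog ψ h)
    (hf : IsLogRep ψ f w H) : radialSup h ≤ boundaryDist f := by
  have hopen := isOpen_image_of_injOn hf.differentiableOn (hf.injOn hψ) subset_rfl isOpen_disk
  have hne : (frontier (f '' disk)).Nonempty :=
    nonempty_frontier_iff.mpr ⟨⟨_, 0, zero_mem_disk, rfl⟩, image_disk_ne_univ hψ hf⟩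
  rw [boundaryDist, hf.map_zero, le_infDist hne]
  intro y hy
  by_contra hlt
  rw [hopen.frontier_eq] at hy
  exact hy.2 (ball_radialSup_subset hψ hh hf (by simpa using hlt))

theorem boundaryDist_extremal (hψ : IsMaMinda ψ) (hh : IsExtremalLog ψ h) :
    boundaryDist (extremal ψ) = radialSup h := by
  refine le_antisymm ?_ (radialSup_le_boundaryDist hψ hh hh.rep)
  have hfr : -((radialSup h : ℝ) : ℂ) ∈ frontier (extremal ψ '' disk) := by
    rw [(isOpen_image_of_injOn hh.rep.differentiableOn (hh.rep.injOn hψ) subset_rfl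
      isOpen_disk).frontier_eq]
    refine ⟨Metric.mem_closure_iff.mpr fun ε hε => ?_, neg_radialSup_notMem hψ hh⟩
    obtain ⟨r, hr, hlt⟩ := exists_lt_radialMod (h := h) (y := radialSup h - ε) (by linarith)
    refine ⟨_, ⟨-(r : ℂ), neg_ofReal_mem_disk hr.1 hr.2, rfl⟩, ?_⟩
    rw [extremal_neg_ofReal hψ hh ⟨by linarith [hr.1], hr.2⟩, dist_neg_neg, dist_eq_norm,
      ← Complex.ofReal_sub, Complex.norm_real, Real.norm_eq_abs, abs_lt]
    constructor <;> linarith [radialMod_lt_radialSup hψ hh hr]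
  have := infDist_le_dist_of_mem (x := extremal ψ 0) hfr
  rw [hh.rep.map_zero, dist_zero_left, norm_neg, Complex.norm_real,
    Real.norm_of_nonneg (radialSup_pos hψ hh).le, ← hh.rep.map_zero] at this
  exact this

end

/-! ### Coefficients of Λ = log((ψ - 1) / (ψ'(0) z)). -/

section

/-- A typically real function, multiplied by `(1 - z²) / z`, has positive real part. -/
theorem re_one_sub_sq_mul_nonneg {κ : ℂ → ℂ} (hκ : DifferentiableOn ℂ κ disk)
    (htr : ∀ z ∈ disk, 0 ≤ z.im * (z * κ z).im) {z : ℂ} (hz : z ∈ disk) :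
    0 ≤ ((1 - z ^ 2) * κ z).re := by
  -- Only κ is dilated. On |x| = 1 one has (1 - x²)/x = -2i Im x, which makes the real part a
  -- nonnegative multiple of Im x · Im(ρx κ(ρx)); the maximum principle for the exponential of the
  -- negative carries this inside.
  have key : ∀ ρ ∈ Ioo (0 : ℝ) 1, 0 ≤ ((1 - z ^ 2) * κ (ρ * z)).re := by
    intro ρ hρ
    have hm : MapsTo (fun x : ℂ => (ρ : ℂ) * x) (closedBall 0 1) disk := by
      intro x hx
      have hx' : ‖x‖ ≤ 1 := by simpa using hx
      rw [mem_disk_iff, norm_mul, Complex.norm_real, Real.norm_of_nonneg hρ.1.le]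
      nlinarith [hρ.1, hρ.2]
    have hd : DifferentiableOn ℂ (fun x => Complex.exp (-((1 - x ^ 2) * κ (ρ * x)))) (closedBall 0 1) := by
      have : DifferentiableOn ℂ (fun x => κ (ρ * x)) (closedBall 0 1) := hκ.comp (by fun_prop) hm
      fun_prop
    have h1 : ‖Complex.exp (-((1 - z ^ 2) * κ (ρ * z)))‖ ≤ 1 := by
      refine Complex.norm_le_of_forall_mem_frontier_norm_le
        (f := fun x => Complex.exp (-((1 - x ^ 2) * κ (ρ * x)))) (isBounded_ball (x := (0 : ℂ)) (r := 1))
        (hd.diffContOnCl_ball subset_rfl) ?_ (subset_closure hz)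
      intro x hx
      rw [frontier_ball _ one_ne_zero] at hx
      have hxn : ‖x‖ = 1 := by simpa using hx
      have hxm : (ρ : ℂ) * x ∈ disk := hm (sphere_subset_closedBall hx)
      have h2 := htr _ hxm
      have hnsq : x.re * x.re + x.im * x.im = 1 := by
        rw [← Complex.normSq_apply, Complex.normSq_eq_norm_sq, hxn, one_pow]
      rw [Complex.norm_exp, Real.exp_le_one_iff, neg_re, neg_nonpos]
      set k := κ (ρ * x)
      have e1 : (((ρ : ℂ) * x).im * ((ρ : ℂ) * x * k).im) =
          ρ ^ 2 * (x.im * (x.re * k.im + x.im * k.re)) := by simp; ring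
      have e2 : ((1 - x ^ 2) * k).re = 2 * (x.im * (x.re * k.im + x.im * k.re)) := by
        simp [pow_two]
        linear_combination (-k.re) * hnsq
      rw [e1] at h2
      rw [e2]
      have h3 := nonneg_of_mul_nonneg_right h2 (by have := hρ.1; positivity)
      linarith
    rw [Complex.norm_exp, Real.exp_le_one_iff, neg_re] at h1
    linarith
  have hc : ContinuousAt (fun ρ : ℝ => ((1 - z ^ 2) * κ (ρ * z)).re) 1 := by
    have h1 : ContinuousAt κ (((1 : ℝ) : ℂ) * z) := by
      have : ((1 : ℝ) : ℂ) * z ∈ disk := by simpa using hz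
      exact (hκ.differentiableAt (isOpen_disk.mem_nhds this)).continuousAt
    have h2 : ContinuousAt (fun ρ : ℝ => (ρ : ℂ) * z) 1 := by fun_prop
    exact Complex.continuous_re.continuousAt.comp
      (continuousAt_const.mul (ContinuousAt.comp (f := fun ρ : ℝ => (ρ : ℂ) * z) h1 h2))
  have hlim := hc.tendsto.mono_left (nhdsWithin_le_nhds (s := Iio 1))
  simp only [Complex.ofReal_one, one_mul] at hlim
  exact ge_of_tendsto hlim (mem_of_superset (Ioo_mem_nhdsLT (zero_lt_one' ℝ)) fun ρ hρ => key ρ hρ)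

theorem re_pos_of_re_nonneg {p : ℂ → ℂ} (hp : DifferentiableOn ℂ p disk)
    (hre : ∀ z ∈ disk, 0 ≤ (p z).re) (h0 : 0 < (p 0).re) {z : ℂ} (hz : z ∈ disk) : 0 < (p z).re := by
  refine (hre z hz).lt_of_ne fun heq => ?_
  have hd : DifferentiableOn ℂ (fun x => Complex.exp (-p x)) disk := by fun_prop
  have hconst := Complex.eqOn_of_isPreconnected_of_isMaxOn_norm isPreconnected_disk isOpen_disk hd hz
    (fun x hx => by simpa [Complex.norm_exp, ← heq] using hre x hx)
  have := congrArg norm (hconst zero_mem_disk)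
  simp [Complex.norm_exp, ← heq] at this
  linarith

/-- The first two coefficients of the logarithm of a Carathéodory function. -/
theorem norm_taylorCoeff_log_two_le {p : ℂ → ℂ} (hp : DifferentiableOn ℂ p disk)
    (hre : ∀ z ∈ disk, 0 < (p z).re) (h0 : p 0 = 1) :
    ‖taylorCoeff (fun z => Complex.log (p z)) 1‖ ≤ 2 ∧
    ‖taylorCoeff (fun z => Complex.log (p z)) 2‖ ≤
      2 - ‖taylorCoeff (fun z => Complex.log (p z)) 1‖ ^ 2 / 2 := by
  set l : ℂ → ℂ := fun z => Complex.log (p z)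
  have hld : DifferentiableOn ℂ l disk := hp.clog fun z hz => Or.inl (hre z hz)
  have hpa := analyticAt_zero hp
  have hla := analyticAt_zero hld
  -- the relation `p' = l' p`
  have hrel : taylorPS (deriv p) = taylorPS (deriv l) * taylorPS p := by
    rw [← taylorPS_mul hla.deriv hpa]
    refine taylorPS_congr ?_
    filter_upwards [isOpen_disk.mem_nhds zero_mem_disk] with z hz
    have h1 := (hp.differentiableAt (isOpen_disk.mem_nhds hz)).hasDerivAt.clog (Or.inl (hre z hz))
    rw [h1.deriv, div_mul_cancel₀]
    intro h2
    simpa [h2] using hre z hz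
  have e0 := congrArg (coeff 0) hrel
  have e1 := congrArg (coeff 1) hrel
  simp only [coeff_mul, Finset.Nat.antidiagonal_zero, Finset.Nat.antidiagonal_succ] at e0 e1
  simp [taylorCoeff_deriv, h0, -coeff_zero_eq_constantCoeff] at e0 e1
  rw [← taylorCoeff_one] at e0
  -- the Schwarz function `(p - 1) / (p + 1)`
  have hden : ∀ z ∈ disk, p z + 1 ≠ 0 := fun z hz h => by
    have h1 := congrArg re h
    simp at h1
    linarith [hre z hz]
  set σ : ℂ → ℂ := fun z => (p z - 1) / (p z + 1) with hσ
  have hσd : DifferentiableOn ℂ σ disk := (hp.sub_const 1).div (hp.add_const 1) hden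
  have hσ0 : σ 0 = 0 := by simp [hσ, h0]
  have hσb : ∀ z ∈ disk, ‖σ z‖ ≤ 1 := by
    intro z hz
    rw [hσ, norm_div, div_le_one (norm_pos_iff.mpr (hden z hz)), ← sq_le_sq₀ (norm_nonneg _)
        (norm_nonneg _), ← Complex.normSq_eq_norm_sq, ← Complex.normSq_eq_norm_sq]
    simp only [normSq_apply]
    simp
    nlinarith [hre z hz]
  have hσa := analyticAt_zero hσd
  have hrel2 : (taylorPS p + C 1) * taylorPS σ = taylorPS p - C 1 := by
    rw [← taylorPS_const, ← taylorPS_add hpa analyticAt_const, ← taylorPS_sub hpa analyticAt_const,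
      ← taylorPS_mul (by fun_prop) hσa]
    refine taylorPS_congr ?_
    filter_upwards [isOpen_disk.mem_nhds zero_mem_disk] with z hz
    rw [hσ, mul_div_cancel₀ _ (hden z hz)]
  have s1 := congrArg (coeff 1) hrel2
  have s2 := congrArg (coeff 2) hrel2
  simp only [coeff_mul, Finset.Nat.antidiagonal_zero, Finset.Nat.antidiagonal_succ] at s1 s2
  simp [h0, hσ0, coeff_one, -coeff_zero_eq_constantCoeff] at s1 s2
  -- Schwarz-Pick for `σ(z) / z`
  have hτd := differentiableOn_dslope_zero hσd
  have hτb : ∀ z ∈ disk, ‖dslope σ 0 z‖ ≤ 1 := by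
    intro z hz
    have := norm_dslope_le_div_of_mapsTo_ball (R₁ := 1) (R₂ := 1) (c := 0) hσd
      (fun x hx => by simpa [hσ0] using hσb x hx) hz
    simpa using this
  have t0 : dslope σ 0 0 = taylorCoeff σ 1 := by rw [dslope_same, taylorCoeff_one]
  have t1 := norm_taylorCoeff_le_one_sub_sq hτd hτb one_ne_zero
  rw [taylorCoeff_dslope hσa, t0] at t1
  have t2 := hτb 0 zero_mem_disk
  rw [t0] at t2
  -- Since log p = 2(σ + σ³/3 + ⋯) with σ(0) = 0, the first two coefficients of log p are twice
  -- those of σ.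
  have f1 : taylorCoeff l 1 = 2 * taylorCoeff σ 1 := by linear_combination -e0 - s1
  have f2 : taylorCoeff l 2 = 2 * taylorCoeff σ (1 + 1) := by
    rw [f1] at e1
    linear_combination -e1 / 2 - s2
  rw [f2, f1]
  simp only [norm_mul, Complex.norm_ofNat]
  constructor
  · linarith
  · nlinarith

/-- As |arg p| < π/2, the function π/2 + i log p has nonnegative real part and equals π/2 at 0;
Carathéodory's inequality doubles that value. -/
theorem norm_taylorCoeff_log_le_pi {p : ℂ → ℂ} (hp : DifferentiableOn ℂ p disk)
    (hre : ∀ z ∈ disk, 0 < (p z).re) (h0 : p 0 = 1) {n : ℕ} (hn : n ≠ 0) :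
    ‖taylorCoeff (fun z => Complex.log (p z)) n‖ ≤ Real.pi := by
  set l : ℂ → ℂ := fun z => Complex.log (p z)
  have hld : DifferentiableOn ℂ l disk := hp.clog fun z hz => Or.inl (hre z hz)
  have hla := analyticAt_zero hld
  have hf : DifferentiableOn ℂ (fun z => ((Real.pi / 2 : ℝ) : ℂ) + I * l z) disk := by fun_prop
  have h1 := norm_taylorCoeff_le_two_mul_re hf ?_ ?_ hn
  · have h2 : taylorPS (fun z => ((Real.pi / 2 : ℝ) : ℂ) + I * l z) =
        C ((Real.pi / 2 : ℝ) : ℂ) + C I * taylorPS l := by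
      rw [← taylorPS_const, ← taylorPS_const, ← taylorPS_mul analyticAt_const hla,
        ← taylorPS_add analyticAt_const (by fun_prop)]
    have h3 := congrArg (coeff n) h2
    simp only [coeff_taylorPS, map_add, coeff_C, hn, if_false, coeff_C_mul, zero_add] at h3
    rw [h3, norm_mul, Complex.norm_I, one_mul] at h1
    simp [l, h0] at h1
    linarith
  · intro z hz
    have := (abs_lt.mp (Complex.abs_arg_lt_pi_div_two_iff.mpr (Or.inl (hre z hz)))).2
    simp [l, Complex.log_im]
    linarith
  · simp [l, h0, Real.pi_pos]

theorem taylorCoeff_neg_log_add (n : ℕ) :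
    taylorCoeff (fun z => -Complex.log (1 - z) + -Complex.log (1 + z)) n = (1 + (-1) ^ n) / n := by
  refine taylorCoeff_eq_of_hasSum (a := fun n : ℕ => ((1 + (-1) ^ n) / n : ℂ)) ?_ n
  filter_upwards [ball_mem_nhds (0 : ℂ) one_pos] with z hz
  have hz' : ‖z‖ < 1 := by simpa using hz
  have h1 := Complex.hasSum_taylorSeries_neg_log hz'
  have h2 := Complex.hasSum_taylorSeries_neg_log (z := -z) (by simpa using hz')
  rw [sub_neg_eq_add] at h2
  convert! h1.add h2 using 2 with n
  rw [neg_pow]; ring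

/-- The logarithm of `(ψ(z) - 1) / (ψ'(0) z)`, with estimates of its coefficients. -/
theorem IsMaMinda.exists_log_slope {ψ : ℂ → ℂ} (hψ : IsMaMinda ψ) :
    ∃ Λ : ℂ → ℂ, DifferentiableOn ℂ Λ disk ∧
      (∀ z ∈ disk, dslope ψ 0 z = deriv ψ 0 * Complex.exp (Λ z)) ∧
      ‖taylorCoeff Λ 1‖ ≤ 2 ∧ ‖taylorCoeff Λ 2‖ ≤ 3 - ‖taylorCoeff Λ 1‖ ^ 2 / 2 ∧
      ∀ n, 3 ≤ n → ‖taylorCoeff Λ n‖ ≤ Real.pi + 1 / 2 := by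
  have hd0 : deriv ψ 0 ≠ 0 := fun h => by simpa [h] using hψ.deriv_re_pos
  have hBr : deriv ψ 0 = (((deriv ψ 0).re : ℝ) : ℂ) := Complex.ext (by simp) (by simp [hψ.deriv_im])
  have hpos := hψ.deriv_re_pos
  set B := (deriv ψ 0).re
  set κ : ℂ → ℂ := fun z => dslope ψ 0 z / B with hκ
  have hBc : (B : ℂ) ≠ 0 := hBr ▸ hd0
  have hκd : DifferentiableOn ℂ κ disk := (differentiableOn_dslope_zero hψ.analytic).div_const _
  have htr : ∀ z ∈ disk, 0 ≤ z.im * (z * κ z).im := by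
    intro z hz
    have h1 : z * κ z = (ψ z - 1) / B := by
      rw [hκ, self_eq_add_mul_dslope ψ z, hψ.map_zero]; ring
    rw [h1, Complex.div_ofReal_im, sub_im, one_im, sub_zero, ← mul_div_assoc]
    exact div_nonneg (hψ.im_mul_im_nonneg hz) hpos.le
  set p : ℂ → ℂ := fun z => (1 - z ^ 2) * κ z with hp
  have hpd : DifferentiableOn ℂ p disk := by fun_prop
  have hp0 : p 0 = 1 := by
    simp only [hp, hκ, dslope_same, hBr]
    field_simp
    simp
  have hpre : ∀ z ∈ disk, 0 < (p z).re := fun z hz =>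
    re_pos_of_re_nonneg hpd (fun z hz => re_one_sub_sq_mul_nonneg hκd htr hz) (by simp [hp0]) hz
  have hsub : ∀ z ∈ disk, 0 < (1 - z).re := by
    intro z hz
    have := (abs_lt.mp ((Complex.abs_re_le_norm z).trans_lt (mem_disk_iff.mp hz))).2
    simp; linarith
  have hadd : ∀ z ∈ disk, 0 < (1 + z).re := by
    intro z hz
    have := (abs_lt.mp ((Complex.abs_re_le_norm z).trans_lt (mem_disk_iff.mp hz))).1
    simp; linarith
  have hld : DifferentiableOn ℂ (fun z => Complex.log (p z)) disk :=
    hpd.clog fun z hz => Or.inl (hpre z hz)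
  have hqd : DifferentiableOn ℂ (fun z : ℂ => -Complex.log (1 - z) + -Complex.log (1 + z)) disk :=
    ((differentiableOn_const _).sub differentiableOn_id |>.clog fun z hz => Or.inl (hsub z hz)).neg.add
    ((differentiableOn_const _).add differentiableOn_id |>.clog fun z hz => Or.inl (hadd z hz)).neg
  have hco : ∀ n, taylorCoeff (fun z => Complex.log (p z) +
      (-Complex.log (1 - z) + -Complex.log (1 + z))) n =
      taylorCoeff (fun z => Complex.log (p z)) n + (1 + (-1) ^ n) / n := by
    intro n
    rw [← taylorCoeff_neg_log_add, ← coeff_taylorPS, ← coeff_taylorPS, ← coeff_taylorPS, ← map_add,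
      ← taylorPS_add (analyticAt_zero hld) (analyticAt_zero hqd)]
  obtain ⟨hl1, hl2⟩ := norm_taylorCoeff_log_two_le hpd hpre hp0
  have hg1 : taylorCoeff (fun z => Complex.log (p z) +
      (-Complex.log (1 - z) + -Complex.log (1 + z))) 1 = taylorCoeff (fun z => Complex.log (p z)) 1 := by
    rw [hco]; simp
  refine ⟨fun z => Complex.log (p z) + (-Complex.log (1 - z) + -Complex.log (1 + z)), hld.add hqd,
    ?_, ?_, ?_, ?_⟩
  · intro z hz
    have n1 : p z ≠ 0 := fun h => by simpa [h] using hpre z hz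
    have n2 : 1 - z ≠ 0 := fun h => by simpa [h] using hsub z hz
    have n3 : 1 + z ≠ 0 := fun h => by simpa [h] using hadd z hz
    rw [Complex.exp_add, Complex.exp_add, Complex.exp_neg, Complex.exp_neg, Complex.exp_log n1,
      Complex.exp_log n2, Complex.exp_log n3, hBr]
    simp only [hp, hκ]
    field_simp
    ring
  · rw [hg1]; exact hl1
  · rw [hg1, hco]
    have : ((1 + (-1) ^ 2) / (2 : ℕ) : ℂ) = 1 := by norm_num
    rw [this]
    refine (norm_add_le _ _).trans ?_
    rw [norm_one]
    linarith
  · intro n hn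
    rw [hco]
    refine (norm_add_le _ _).trans (add_le_add (norm_taylorCoeff_log_le_pi hpd hpre hp0 (by omega)) ?_)
    rcases Nat.even_or_odd n with he | ho
    · rw [he.neg_one_pow, norm_div, Complex.norm_natCast]
      have h4 : 4 ≤ n := by
        rcases he with ⟨k, rfl⟩; omega
      have h4' : (4 : ℝ) ≤ n := by exact_mod_cast h4
      rw [div_le_div_iff₀ (by linarith) (by norm_num)]
      norm_num
      linarith
    · rw [ho.neg_one_pow]; simp

end

/-! ### The comparison estimate for the germ v at radius 1/3. -/

section

theorem sum_geom_third_le (N : ℕ) : ∑ m ∈ Finset.range N, (1 / 3 : ℝ) ^ (m + 1) ≤ 1 / 2 := by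
  have : ∑ m ∈ Finset.range N, (1 / 3 : ℝ) ^ (m + 1) = 1 / 2 - (1 / 3) ^ N / 2 := by
    induction N with
    | zero => norm_num
    | succ N ih => rw [Finset.sum_range_succ, ih]; ring
  rw [this]
  have : (0 : ℝ) ≤ (1 / 3) ^ N := by positivity
  linarith

theorem sum_mul_geom_third_le (N : ℕ) :
    ∑ m ∈ Finset.range N, ((m + 3 : ℕ) : ℝ) * (1 / 3 : ℝ) ^ (m + 2) ≤ 7 / 12 := by
  have : ∑ m ∈ Finset.range N, ((m + 3 : ℕ) : ℝ) * (1 / 3 : ℝ) ^ (m + 2) =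
      7 / 12 - (2 * N + 7) / 12 * (1 / 3) ^ N := by
    induction N with
    | zero => norm_num
    | succ N ih => rw [Finset.sum_range_succ, ih]; push_cast; ring
  rw [this]
  have : (0 : ℝ) ≤ (2 * N + 7) / 12 * (1 / 3) ^ N := by positivity
  linarith

/-- The first two terms are kept exactly and the later denominators are replaced by 4. The extra
summand in `key` is that geometric tail, and 1/6 + 1/27 + 1/72 = 47/216. -/
theorem sum_geom_third_div_le (N : ℕ) :
    ∑ m ∈ Finset.range N, (1 / 3 : ℝ) ^ (m + 1) / (m + 2) ≤ 47 / 216 := by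
  have key : ∀ M : ℕ, ∑ m ∈ Finset.range (M + 2), (1 / 3 : ℝ) ^ (m + 1) / (m + 2) +
      (1 / 3) ^ (M + 2) / 8 ≤ 47 / 216 := by
    intro M
    induction M with
    | zero => norm_num [Finset.sum_range_succ]
    | succ M ih =>
      rw [Finset.sum_range_succ]
      have h1 : (1 / 3 : ℝ) ^ (M + 2 + 1) / ((M + 2 : ℕ) + 2) ≤ (1 / 3 : ℝ) ^ (M + 2 + 1) / 4 := by
        gcongr
        push_cast
        linarith [(Nat.cast_nonneg M : (0 : ℝ) ≤ M)]
      have h2 : (1 / 3 : ℝ) ^ (M + 2 + 1) = (1 / 3) ^ (M + 2) / 3 := by ring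
      have h3 : M + 1 + 2 = M + 2 + 1 := by ring
      rw [h3]
      linarith
  have h1 := key N
  rw [Finset.sum_range_succ, Finset.sum_range_succ] at h1
  have h2 : (0 : ℝ) ≤ (1 / 3) ^ (N + 1) / ((N : ℕ) + 2) := by positivity
  have h3 : (0 : ℝ) ≤ (1 / 3) ^ (N + 1 + 1) / ((N + 1 : ℕ) + 2) := by positivity
  have h4 : (0 : ℝ) ≤ (1 / 3) ^ (N + 2) / 8 := by positivity
  linarith

theorem sum_geom_third_mul_div_le (N : ℕ) :
    ∑ m ∈ Finset.range N, (1 / 3 : ℝ) ^ (m + 1) * ((m + 1) / (m + 2)) ≤ 8 / 27 := by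
  have key : ∀ M : ℕ, ∑ m ∈ Finset.range (M + 2), (1 / 3 : ℝ) ^ (m + 1) * ((m + 1) / (m + 2)) +
      (1 / 3) ^ (M + 2) / 2 ≤ 8 / 27 := by
    intro M
    induction M with
    | zero => norm_num [Finset.sum_range_succ]
    | succ M ih =>
      rw [Finset.sum_range_succ]
      have h1 : (1 / 3 : ℝ) ^ (M + 2 + 1) * (((M + 2 : ℕ) + 1) / ((M + 2 : ℕ) + 2)) ≤
          (1 / 3 : ℝ) ^ (M + 2 + 1) := by
        refine mul_le_of_le_one_right (by positivity) ?_
        rw [div_le_one (by positivity)]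
        linarith
      have h2 : (1 / 3 : ℝ) ^ (M + 2 + 1) = (1 / 3) ^ (M + 2) / 3 := by ring
      have h3 : M + 1 + 2 = M + 2 + 1 := by ring
      rw [h3]
      linarith
  have h1 := key N
  rw [Finset.sum_range_succ, Finset.sum_range_succ] at h1
  have h2 : (0 : ℝ) ≤ (1 / 3) ^ (N + 1) * (((N : ℕ) + 1) / ((N : ℕ) + 2)) := by positivity
  have h3 : (0 : ℝ) ≤ (1 / 3) ^ (N + 1 + 1) * (((N + 1 : ℕ) + 1) / ((N + 1 : ℕ) + 2)) := by positivity
  have h4 : (0 : ℝ) ≤ (1 / 3) ^ (N + 2) / 2 := by positivity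
  linarith

/-- The numerical inequalities that close the induction in `majSum_le_third`. -/
theorem numeric_bounds {c : ℝ} (h0 : 0 ≤ c) (h1 : c ≤ 1) {D x T : ℝ} (hD : D = 9 / 25 * (1 - c))
    (hx : x = 122 / 25 * D)
    (hT : T ≤ (c + (1 - c ^ 2) / 2) * (5 / 6 * D + 1 / 5 * (17 / 8 * D + x ^ 2 / 2 / (1 - x / 3)))) :
    1 / 3 * (8 / 27 * (1 - c ^ 2) + T) ≤ D ∧ c + 47 / 216 * (1 - c ^ 2) + T ≤ 1 := by
  -- In terms of ε = 1 - c every quantity carries a factor ε, apart from c + (1 - c²)/2 = 1 - ε²/2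
  -- and the denominator 1 - x/3. Multiplying by this positive denominator leaves polynomial
  -- inequalities.
  obtain ⟨ε, rfl⟩ : ∃ ε, c = 1 - ε := ⟨1 - c, by ring⟩
  have he0 : 0 ≤ ε := by linarith
  have he1 : ε ≤ 1 := by linarith
  have hx' : x = 1098 / 625 * ε := by rw [hx, hD]; ring
  have hpos : 0 < 1 - x / 3 := by rw [hx']; linarith
  have hD' : D = 9 / 25 * ε := by rw [hD]; ring
  set q := x ^ 2 / 2 / (1 - x / 3) with hq
  have hqe : q * (1 - x / 3) = x ^ 2 / 2 := by rw [hq, div_mul_cancel₀ _ hpos.ne']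
  clear_value q
  subst hx' hD'
  have hm : 0 ≤ 1 - ε ^ 2 / 2 := by nlinarith
  have hT' : T ≤ (1 - ε ^ 2 / 2) * (453 / 1000 * ε + q / 5) := by
    refine hT.trans (le_of_eq ?_)
    ring
  have h3 : 0 ≤ ε ^ 3 := by positivity
  constructor
  · have key : 0 ≤ (9 / 25 * ε - 1 / 3 * (8 / 27 * (ε * (2 - ε)) +
        (1 - ε ^ 2 / 2) * (453 / 1000 * ε + q / 5))) * (1 - 1098 / 625 * ε / 3) := by
      have e : (9 / 25 * ε - 1 / 3 * (8 / 27 * (ε * (2 - ε)) +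
          (1 - ε ^ 2 / 2) * (453 / 1000 * ε + q / 5))) * (1 - 1098 / 625 * ε / 3) =
          ε * ((1 - 366 / 625 * ε) * (9 / 25 - 16 / 81 - 151 / 1000 + 8 / 81 * ε + 151 / 2000 * ε ^ 2) -
            1 / 15 * (1 - ε ^ 2 / 2) * (602802 / 390625 * ε)) := by
        linear_combination (-(1 / 15) * (1 - ε ^ 2 / 2)) * hqe
      rw [e]
      refine mul_nonneg he0 ?_
      nlinarith [sq_nonneg (ε - 1 / 3)]
    have := nonneg_of_mul_nonneg_left key hpos
    linarith
  · have key : 0 ≤ (ε - 47 / 216 * (ε * (2 - ε)) -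
        (1 - ε ^ 2 / 2) * (453 / 1000 * ε + q / 5)) * (1 - 1098 / 625 * ε / 3) := by
      have e : (ε - 47 / 216 * (ε * (2 - ε)) -
          (1 - ε ^ 2 / 2) * (453 / 1000 * ε + q / 5)) * (1 - 1098 / 625 * ε / 3) =
          ε * ((1 - 366 / 625 * ε) * (1 - 47 / 108 - 453 / 1000 + 47 / 216 * ε + 453 / 2000 * ε ^ 2) -
            1 / 5 * (1 - ε ^ 2 / 2) * (602802 / 390625 * ε)) := by
        linear_combination (-(1 / 5) * (1 - ε ^ 2 / 2)) * hqe
      rw [e]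
      refine mul_nonneg he0 ?_
      nlinarith [sq_nonneg (ε - 4 / 5)]
    have := nonneg_of_mul_nonneg_left key hpos
    linarith

/-- The majorant sum of `P` with the `n`-th coefficient divided by `n + 1`. -/
noncomputable def majInt (r : ℝ) (N : ℕ) (P : PowerSeries ℂ) : ℝ :=
  ∑ n ∈ Finset.range N, ‖coeff n P‖ / (n + 1) * r ^ n

theorem majInt_add_le {r : ℝ} (hr : 0 ≤ r) {N : ℕ} (P Q : PowerSeries ℂ) :
    majInt r N (P + Q) ≤ majInt r N P + majInt r N Q := by
  rw [majInt, majInt, majInt, ← Finset.sum_add_distrib]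
  refine Finset.sum_le_sum fun n _ => ?_
  rw [← add_mul, ← add_div, map_add]
  gcongr
  exact norm_add_le _ _

/-- Integration gains a factor 1/(k+1) on a series of order k; this gain is what makes the constants
small enough. -/
theorem majInt_le_of_X_pow_dvd {r : ℝ} (hr : 0 ≤ r) {N k : ℕ} {P : PowerSeries ℂ} (h : X ^ k ∣ P) :
    majInt r N P ≤ majSum r N P / (k + 1) := by
  rw [majInt, majSum, Finset.sum_div]
  refine Finset.sum_le_sum fun n _ => ?_
  rcases lt_or_ge n k with hn | hn
  · simp [X_pow_dvd_iff.mp h n hn]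
  · have hn' : (k : ℝ) ≤ n := by exact_mod_cast hn
    rw [div_mul_eq_mul_div]
    gcongr

/-- Coefficients obeying the bounds for a function of modulus at most one. -/
structure IsSchurSeries (Ω : PowerSeries ℂ) : Prop where
  norm_zero_le : ‖coeff 0 Ω‖ ≤ 1
  norm_coeff_le : ∀ n, n ≠ 0 → ‖coeff n Ω‖ ≤ 1 - ‖coeff 0 Ω‖ ^ 2

namespace IsSchurSeries

variable {Ω : PowerSeries ℂ}

theorem sq_le (h : IsSchurSeries Ω) : ‖coeff 0 Ω‖ ^ 2 ≤ 1 := by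
  nlinarith [h.norm_zero_le, norm_nonneg (coeff 0 Ω)]

theorem majSum_le (h : IsSchurSeries Ω) (N : ℕ) :
    majSum (1 / 3) N Ω ≤ ‖coeff 0 Ω‖ + (1 - ‖coeff 0 Ω‖ ^ 2) / 2 := by
  have h1 := h.sq_le
  refine (majSum_mono (by norm_num) (Nat.le_succ N) Ω).trans ?_
  rw [majSum, Finset.sum_range_succ']
  have h2 : ∑ n ∈ Finset.range N, ‖coeff (n + 1) Ω‖ * (1 / 3 : ℝ) ^ (n + 1) ≤
      (1 - ‖coeff 0 Ω‖ ^ 2) * (1 / 2) := by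
    calc _ ≤ ∑ n ∈ Finset.range N, (1 - ‖coeff 0 Ω‖ ^ 2) * (1 / 3 : ℝ) ^ (n + 1) :=
          Finset.sum_le_sum fun n _ => by gcongr; exact h.norm_coeff_le _ n.succ_ne_zero
      _ ≤ _ := by
          rw [← Finset.mul_sum]
          exact mul_le_mul_of_nonneg_left (sum_geom_third_le N) (by linarith)
  rw [pow_zero, mul_one]
  linarith

/-- Bohr's theorem: with c the modulus of the constant term, c + (1 - c²)/2 = 1 - (1 - c)²/2. -/
theorem majSum_le_one (h : IsSchurSeries Ω) (N : ℕ) : majSum (1 / 3) N Ω ≤ 1 := by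
  have := h.majSum_le N
  nlinarith [sq_nonneg (1 - ‖coeff 0 Ω‖)]

theorem majInt_le (h : IsSchurSeries Ω) (N : ℕ) :
    majInt (1 / 3) N Ω ≤ ‖coeff 0 Ω‖ + 47 / 216 * (1 - ‖coeff 0 Ω‖ ^ 2) := by
  have h1 := h.sq_le
  cases N with
  | zero => simp only [majInt, Finset.range_zero, Finset.sum_empty]; nlinarith [norm_nonneg (coeff 0 Ω)]
  | succ N =>
  rw [majInt, Finset.sum_range_succ']
  have h2 : ∑ n ∈ Finset.range N, ‖coeff (n + 1) Ω‖ / ((n + 1 : ℕ) + 1) * (1 / 3 : ℝ) ^ (n + 1) ≤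
      (1 - ‖coeff 0 Ω‖ ^ 2) * (47 / 216) := by
    calc _ ≤ ∑ n ∈ Finset.range N, (1 - ‖coeff 0 Ω‖ ^ 2) * ((1 / 3 : ℝ) ^ (n + 1) / (n + 2)) :=
          Finset.sum_le_sum fun n _ => by
            have e : (1 - ‖coeff 0 Ω‖ ^ 2) * ((1 / 3 : ℝ) ^ (n + 1) / (n + 2)) =
              (1 - ‖coeff 0 Ω‖ ^ 2) / ((n + 1 : ℕ) + 1) * (1 / 3 : ℝ) ^ (n + 1) := by
                push_cast; ring
            rw [e]
            gcongr; exact h.norm_coeff_le _ n.succ_ne_zero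
      _ ≤ _ := by
          rw [← Finset.mul_sum]
          exact mul_le_mul_of_nonneg_left (sum_geom_third_div_le N) (by linarith)
  simp only [pow_zero, mul_one, CharP.cast_eq_zero, zero_add, div_one]
  linarith

theorem sum_mul_div_le (h : IsSchurSeries Ω) (N : ℕ) :
    ∑ n ∈ Finset.range N, ‖coeff n Ω‖ * (n / (n + 1)) * (1 / 3 : ℝ) ^ n ≤
      8 / 27 * (1 - ‖coeff 0 Ω‖ ^ 2) := by
  have h1 := h.sq_le
  cases N with
  | zero => simp only [Finset.range_zero, Finset.sum_empty]; nlinarith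
  | succ N =>
  rw [Finset.sum_range_succ']
  have h2 : ∑ n ∈ Finset.range N, ‖coeff (n + 1) Ω‖ * ((n + 1 : ℕ) / ((n + 1 : ℕ) + 1)) *
      (1 / 3 : ℝ) ^ (n + 1) ≤ (1 - ‖coeff 0 Ω‖ ^ 2) * (8 / 27) := by
    calc _ ≤ ∑ n ∈ Finset.range N, (1 - ‖coeff 0 Ω‖ ^ 2) * ((1 / 3 : ℝ) ^ (n + 1) * ((n + 1) / (n + 2))) :=
          Finset.sum_le_sum fun n _ => by
            have e : (1 - ‖coeff 0 Ω‖ ^ 2) * ((1 / 3 : ℝ) ^ (n + 1) * ((n + 1) / (n + 2))) =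
              (1 - ‖coeff 0 Ω‖ ^ 2) * ((n + 1 : ℕ) / ((n + 1 : ℕ) + 1)) * (1 / 3 : ℝ) ^ (n + 1) := by
                push_cast; ring
            rw [e]
            gcongr; exact h.norm_coeff_le _ n.succ_ne_zero
      _ ≤ _ := by
          rw [← Finset.mul_sum]
          exact mul_le_mul_of_nonneg_left (sum_geom_third_mul_div_le N) (by linarith)
  simp only [CharP.cast_eq_zero, zero_div, mul_zero, zero_mul]
  linarith

end IsSchurSeries

/-- The factorial of 2 + j is at least 2 · 3^j, so the exponential tail is dominated by a geometric
series. -/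
theorem sum_pow_div_factorial_le {x : ℝ} (h0 : 0 ≤ x) (h3 : x < 3) (N : ℕ) :
    ∑ j ∈ Finset.range N, ‖(1 / (2 + j).factorial : ℂ)‖ * x ^ (2 + j) ≤ x ^ 2 / 2 / (1 - x / 3) := by
  have hfac : ∀ j : ℕ, 2 * 3 ^ j ≤ (2 + j).factorial := by
    intro j
    induction j with
    | zero => simp
    | succ j ih =>
      rw [← add_assoc, Nat.factorial_succ, pow_succ]
      nlinarith
  calc _ ≤ ∑ j ∈ Finset.range N, x ^ 2 / 2 * (x / 3) ^ j := by
        refine Finset.sum_le_sum fun j _ => ?_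
        have h1 : (2 * 3 ^ j : ℝ) ≤ (2 + j).factorial := by exact_mod_cast hfac j
        rw [norm_div, norm_one, Complex.norm_natCast]
        have e : x ^ 2 / 2 * (x / 3) ^ j = 1 / (2 * 3 ^ j) * x ^ (2 + j) := by
          rw [div_pow, pow_add]; field_simp
        rw [e]
        gcongr
    _ = x ^ 2 / 2 * ∑ j ∈ Finset.range N, (x / 3) ^ j := by rw [Finset.mul_sum]
    _ ≤ x ^ 2 / 2 * (1 - x / 3)⁻¹ := by
        gcongr
        rw [← tsum_geometric_of_lt_one (by positivity) (by linarith)]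
        exact (summable_geometric_of_lt_one (by positivity) (by linarith)).sum_le_tsum _
          (fun _ _ => by positivity)
    _ = _ := by ring

theorem X_pow_succ_dvd_pow_sub_pow {w v : PowerSeries ℂ} (hw : X ∣ w) (hv : X ∣ v)
    (hwv : X ^ 2 ∣ w - v) (k : ℕ) : X ^ (k + 1) ∣ w ^ k - v ^ k := by
  cases k with
  | zero => simp
  | succ k =>
    rw [← (Commute.all w v).geom_sum₂_mul]
    have e : (X : PowerSeries ℂ) ^ (k + 1 + 1) = X ^ k * X ^ 2 := by ring
    rw [e]
    refine mul_dvd_mul (Finset.dvd_sum fun i hi => ?_) hwv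
    have hi' := Finset.mem_range.mp hi
    have e2 : (X : PowerSeries ℂ) ^ k = X ^ i * X ^ (k + 1 - 1 - i) := by
      rw [← pow_add]; congr 1; omega
    rw [e2]
    exact mul_dvd_mul (pow_dvd_pow_of_dvd hw i) (pow_dvd_pow_of_dvd hv _)

/-- The formal relations between the series of the Schwarz function `w = z Ω` and of the function
`v` with `z v' = w exp (Λ ∘ w - Λ ∘ v)`. Here `E` is the exponential and `G` its exponent, and `γ`
are the coefficients of `Λ`. -/
structure IsComparison (γ : ℕ → ℂ) (Ω v G E : PowerSeries ℂ) : Prop where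
  schur : IsSchurSeries Ω
  X_dvd : X ∣ v
  ode : ∀ n : ℕ, (n : ℂ) * coeff n v = coeff n (X * Ω * E)
  exp_eq : ∀ K, X ^ K ∣ E - ∑ j ∈ Finset.range K, C (1 / j.factorial : ℂ) * G ^ j
  exponent_eq : ∀ K, X ^ K ∣ G - ∑ n ∈ Finset.range K, C (γ n) * ((X * Ω) ^ n - v ^ n)
  norm_two_le : ‖γ 2‖ ≤ 3 - ‖γ 1‖ ^ 2 / 2
  norm_le : ∀ n, 3 ≤ n → ‖γ n‖ ≤ Real.pi + 1 / 2

namespace IsComparison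

variable {γ : ℕ → ℂ} {Ω v G E : PowerSeries ℂ}

/-- E has constant term 1, so the relation `ode` at n = 1 gives v and w = XΩ the same linear
coefficient. -/
theorem X_sq_dvd_sub (h : IsComparison γ Ω v G E) : X ^ 2 ∣ X * Ω - v := by
  have hE : coeff 0 E = 1 := by
    have h1 := X_pow_dvd_iff.mp (h.exp_eq 1) 0 one_pos
    simp only [Finset.range_one, Finset.sum_singleton, Nat.factorial_zero, Nat.cast_one, div_one,
      map_one, pow_zero, mul_one, map_sub, coeff_zero_one] at h1
    exact sub_eq_zero.mp h1
  have h1 := h.ode 1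
  rw [mul_assoc, coeff_succ_X_mul, Nat.cast_one, one_mul, coeff_mul, Finset.Nat.antidiagonal_zero,
    Finset.sum_singleton, hE, mul_one] at h1
  rw [X_pow_dvd_iff]
  intro m hm
  interval_cases m
  · have := X_dvd_iff.mp h.X_dvd
    simp [this]
  · rw [map_sub, h1, coeff_succ_X_mul, sub_self]

theorem X_pow_dvd_pow_sub_pow (h : IsComparison γ Ω v G E) (k : ℕ) :
    X ^ (k + 1) ∣ (X * Ω) ^ k - v ^ k :=
  X_pow_succ_dvd_pow_sub_pow (dvd_mul_right _ _) h.X_dvd h.X_sq_dvd_sub k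

theorem X_pow_four_dvd_exponent (h : IsComparison γ Ω v G E) :
    X ^ 4 ∣ G - C (γ 1) * (X * Ω - v) - C (γ 2) * ((X * Ω) ^ 2 - v ^ 2) := by
  have h1 := h.exponent_eq 4
  have h2 : X ^ 4 ∣ C (γ 3) * ((X * Ω) ^ 3 - v ^ 3) := (h.X_pow_dvd_pow_sub_pow 3).mul_left _
  have h3 := dvd_add h1 h2
  simp only [Finset.sum_range_succ, Finset.sum_range_zero, pow_zero, sub_self, mul_zero, zero_add,
    pow_one] at h3
  convert! h3 using 1
  ring

theorem X_sq_dvd_exponent (h : IsComparison γ Ω v G E) : X ^ 2 ∣ G := by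
  have h1 := h.exponent_eq 2
  simp only [Finset.sum_range_succ, Finset.sum_range_zero, pow_zero, sub_self, mul_zero, zero_add,
    pow_one] at h1
  exact (dvd_sub_left (h.X_sq_dvd_sub.mul_left _)).mp h1

theorem X_pow_four_dvd_exp (h : IsComparison γ Ω v G E) : X ^ 4 ∣ E - 1 - G := by
  have h1 := h.exp_eq 4
  have h2 : X ^ 4 ∣ G ^ 2 := by
    have := pow_dvd_pow_of_dvd h.X_sq_dvd_exponent 2
    rwa [← pow_mul] at this
  have h3 : X ^ 4 ∣ C (1 / (2 : ℕ).factorial : ℂ) * G ^ 2 + C (1 / (3 : ℕ).factorial : ℂ) * G ^ 3 :=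
    dvd_add (h2.mul_left _) ((h2.trans (pow_dvd_pow _ (by norm_num))).mul_left _)
  have h4 := dvd_add h1 h3
  convert! h4 using 1
  simp only [Finset.sum_range_succ, Finset.sum_range_zero, Nat.factorial_zero, Nat.factorial_one,
    Nat.cast_one, div_one, map_one]
  ring

variable {N : ℕ} {D : ℝ}

theorem majSum_w_le (h : IsComparison γ Ω v G E) : majSum (1 / 3) N (X * Ω) ≤ 1 / 3 := by
  refine (majSum_mono (by norm_num) (Nat.le_succ N) _).trans ?_
  rw [majSum_X_mul]
  linarith [h.schur.majSum_le_one N]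

theorem majSum_exponent_tail_le (h : IsComparison γ Ω v G E)
    (hD : majSum (1 / 3) N (X * Ω - v) ≤ D) (hv : majSum (1 / 3) N v ≤ 1 / 3) :
    majSum (1 / 3) N (G - C (γ 1) * (X * Ω - v) - C (γ 2) * ((X * Ω) ^ 2 - v ^ 2)) ≤ 17 / 8 * D := by
  have hr : (0 : ℝ) ≤ 1 / 3 := by norm_num
  have hD0 : 0 ≤ D := (majSum_nonneg hr _).trans hD
  have h1 : X ^ N ∣ (G - C (γ 1) * (X * Ω - v) - C (γ 2) * ((X * Ω) ^ 2 - v ^ 2)) -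
      ∑ m ∈ Finset.range N, C (γ (3 + m)) * ((X * Ω) ^ (3 + m) - v ^ (3 + m)) := by
    have h2 := (pow_dvd_pow X (Nat.le_add_left N 3)).trans (h.exponent_eq (3 + N))
    rw [Finset.sum_range_add] at h2
    convert! h2 using 1
    simp only [Finset.sum_range_succ, Finset.sum_range_zero]
    ring
  rw [majSum_congr h1]
  refine (majSum_sum_le hr _ _).trans ?_
  calc _ ≤ ∑ m ∈ Finset.range N, (Real.pi + 1 / 2) * D * (((m + 3 : ℕ) : ℝ) * (1 / 3 : ℝ) ^ (m + 2)) := by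
        refine Finset.sum_le_sum fun m _ => ?_
        rw [majSum_C_mul]
        have h3 := majSum_pow_sub_pow_le hr (h.majSum_w_le (N := N)) hv (3 + m)
        have h4 : 3 + m - 1 = m + 2 := by omega
        have h5 := h.norm_le (3 + m) (by omega)
        calc _ ≤ (Real.pi + 1 / 2) * ((3 + m : ℕ) * (1 / 3) ^ (3 + m - 1) * D) := by
              refine mul_le_mul h5 (h3.trans ?_) (majSum_nonneg hr _) (by positivity)
              gcongr
          _ = _ := by rw [h4, add_comm 3 m]; ring
    _ = (Real.pi + 1 / 2) * D * ∑ m ∈ Finset.range N, (((m + 3 : ℕ) : ℝ) * (1 / 3 : ℝ) ^ (m + 2)) := by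
        rw [Finset.mul_sum]
    _ ≤ (Real.pi + 1 / 2) * D * (7 / 12) := by
        gcongr
        exact sum_mul_geom_third_le N
    -- Numerically (π + 1/2) · 7/12 is just below 17/8.
    _ ≤ _ := by
        have := Real.pi_lt_d4
        nlinarith

theorem majSum_sq_sub_sq_le (h : IsComparison γ Ω v G E)
    (hD : majSum (1 / 3) N (X * Ω - v) ≤ D) (hv : majSum (1 / 3) N v ≤ 1 / 3) :
    majSum (1 / 3) N ((X * Ω) ^ 2 - v ^ 2) ≤ 2 / 3 * D := by
  have h3 := majSum_pow_sub_pow_le (by norm_num) (h.majSum_w_le (N := N)) hv 2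
  norm_num at h3 hD ⊢
  linarith

theorem majSum_exponent_le (h : IsComparison γ Ω v G E)
    (hD : majSum (1 / 3) N (X * Ω - v) ≤ D) (hv : majSum (1 / 3) N v ≤ 1 / 3) :
    majSum (1 / 3) N G ≤ 122 / 25 * D := by
  have hr : (0 : ℝ) ≤ 1 / 3 := by norm_num
  have hD0 : 0 ≤ D := (majSum_nonneg hr _).trans hD
  have e : G = (G - C (γ 1) * (X * Ω - v) - C (γ 2) * ((X * Ω) ^ 2 - v ^ 2)) +
      (C (γ 1) * (X * Ω - v) + C (γ 2) * ((X * Ω) ^ 2 - v ^ 2)) := by ring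
  rw [e]
  refine (majSum_add_le hr _ _).trans ?_
  have h1 := h.majSum_exponent_tail_le hD hv
  have h2 := majSum_add_le hr (N := N) (C (γ 1) * (X * Ω - v)) (C (γ 2) * ((X * Ω) ^ 2 - v ^ 2))
  rw [majSum_C_mul, majSum_C_mul] at h2
  have h3 := mul_le_mul_of_nonneg_left hD (norm_nonneg (γ 1))
  have h4 := mul_le_mul (h.norm_two_le) (h.majSum_sq_sub_sq_le hD hv) (majSum_nonneg hr _)
    ((norm_nonneg _).trans h.norm_two_le)
  -- With s = ‖γ 1‖, the factor s + (2/3)(3 - s²/2) + 17/8 is largest at s = 3/2, where it is 39/8 <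
  -- 122/25.
  nlinarith [sq_nonneg (‖γ 1‖ - 3 / 2), mul_nonneg hD0 (sq_nonneg (‖γ 1‖ - 3 / 2))]

theorem majSum_exp_tail_le (h : IsComparison γ Ω v G E) {x : ℝ} (hx3 : x < 3)
    (hx : majSum (1 / 3) N G ≤ x) :
    majSum (1 / 3) N (E - 1 - G) ≤ x ^ 2 / 2 / (1 - x / 3) := by
  have hr : (0 : ℝ) ≤ 1 / 3 := by norm_num
  have hG0 := majSum_nonneg hr (N := N) G
  have h1 : X ^ N ∣ (E - 1 - G) -
      ∑ j ∈ Finset.range N, C (1 / (2 + j).factorial : ℂ) * G ^ (2 + j) := by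
    have h2 := (pow_dvd_pow X (Nat.le_add_left N 2)).trans (h.exp_eq (2 + N))
    rw [Finset.sum_range_add] at h2
    convert! h2 using 1
    simp only [Finset.sum_range_succ, Finset.sum_range_zero, Nat.factorial_zero, Nat.factorial_one,
      Nat.cast_one, div_one, map_one]
    ring
  rw [majSum_congr h1]
  refine (majSum_sum_le hr _ _).trans (le_trans ?_
    (sum_pow_div_factorial_le (hG0.trans hx) hx3 N))
  refine Finset.sum_le_sum fun j _ => ?_
  rw [majSum_C_mul]
  gcongr
  exact (majSum_pow_le hr _ _).trans (by gcongr)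

/-- E - 1 splits into γ₁(w - v), γ₂(w² - v²) and a remainder, of orders at least 2, 3 and 4, so
integration divides their majorants by 3, 4 and 5. -/
theorem majInt_mul_exp_sub_one_le (h : IsComparison γ Ω v G E) {x : ℝ} (hx3 : x < 3)
    (hxD : x = 122 / 25 * D)
    (hD : majSum (1 / 3) N (X * Ω - v) ≤ D) (hv : majSum (1 / 3) N v ≤ 1 / 3) :
    majInt (1 / 3) N (Ω * (E - 1)) ≤ (‖coeff 0 Ω‖ + (1 - ‖coeff 0 Ω‖ ^ 2) / 2) *
      (5 / 6 * D + 1 / 5 * (17 / 8 * D + x ^ 2 / 2 / (1 - x / 3))) := by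
  have hr : (0 : ℝ) ≤ 1 / 3 := by norm_num
  have hD0 : 0 ≤ D := (majSum_nonneg hr _).trans hD
  set m := ‖coeff 0 Ω‖ + (1 - ‖coeff 0 Ω‖ ^ 2) / 2
  have hm : majSum (1 / 3) N Ω ≤ m := h.schur.majSum_le N
  have hm0 : 0 ≤ m := (majSum_nonneg hr _).trans hm
  set R₁ := G - C (γ 1) * (X * Ω - v) - C (γ 2) * ((X * Ω) ^ 2 - v ^ 2)
  set R₂ := E - 1 - G
  have hmul : ∀ (k : ℕ) (P : PowerSeries ℂ) (b : ℝ), X ^ k ∣ P → majSum (1 / 3) N P ≤ b →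
      majInt (1 / 3) N (Ω * P) ≤ m * b / (k + 1) := by
    intro k P b hP hb
    refine (majInt_le_of_X_pow_dvd hr (hP.mul_left Ω)).trans ?_
    gcongr
    exact (majSum_mul_le hr _ _).trans (mul_le_mul hm hb (majSum_nonneg hr _) hm0)
  have hE : Ω * (E - 1) = Ω * (C (γ 1) * (X * Ω - v)) + Ω * (C (γ 2) * ((X * Ω) ^ 2 - v ^ 2)) +
      Ω * (R₁ + R₂) := by
    simp only [R₁, R₂]; ring
  have b1 := hmul 2 (C (γ 1) * (X * Ω - v)) (‖γ 1‖ * D) (h.X_sq_dvd_sub.mul_left _) (by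
    rw [majSum_C_mul]; gcongr)
  have b2 := hmul 3 (C (γ 2) * ((X * Ω) ^ 2 - v ^ 2)) ((3 - ‖γ 1‖ ^ 2 / 2) * (2 / 3 * D))
    ((h.X_pow_dvd_pow_sub_pow 2).mul_left _) (by
      rw [majSum_C_mul]
      exact mul_le_mul h.norm_two_le (h.majSum_sq_sub_sq_le hD hv) (majSum_nonneg hr _)
        ((norm_nonneg _).trans h.norm_two_le))
  have b3 := hmul 4 (R₁ + R₂) (17 / 8 * D + x ^ 2 / 2 / (1 - x / 3))
    (dvd_add h.X_pow_four_dvd_exponent h.X_pow_four_dvd_exp)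
    ((majSum_add_le hr _ _).trans (add_le_add (h.majSum_exponent_tail_le hD hv)
      (h.majSum_exp_tail_le hx3 (hxD ▸ h.majSum_exponent_le hD hv))))
  rw [hE]
  refine (majInt_add_le hr _ _).trans ((add_le_add ((majInt_add_le hr _ _).trans
    (add_le_add b1 b2)) b3).trans ?_)
  push_cast
  -- The left side is maximal at ‖γ 1‖ = 2, where equality holds.
  have hq : ‖γ 1‖ * D / 3 + (3 - ‖γ 1‖ ^ 2 / 2) * (2 / 3 * D) / 4 ≤ 5 / 6 * D := by
    nlinarith [mul_nonneg hD0 (sq_nonneg (‖γ 1‖ - 2))]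
  have := mul_le_mul_of_nonneg_left hq hm0
  linarith

theorem succ_mul_coeff (h : IsComparison γ Ω v G E) (n : ℕ) :
    coeff (n + 1) v = (coeff n Ω + coeff n (Ω * (E - 1))) / (n + 1) := by
  have h1 := h.ode (n + 1)
  rw [mul_assoc, coeff_succ_X_mul] at h1
  have h2 : (n + 1 : ℂ) ≠ 0 := by exact_mod_cast n.succ_ne_zero
  rw [eq_div_iff h2, mul_comm, ← map_add]
  push_cast at h1
  rw [h1]
  congr 1
  ring

/-- The coefficient of index n + 1 in v uses Ω and E only up to index n. This shift from N + 1 to N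
drives the induction. -/
theorem majSum_succ_v_le (h : IsComparison γ Ω v G E) :
    majSum (1 / 3) (N + 1) v ≤ 1 / 3 * (majInt (1 / 3) N Ω + majInt (1 / 3) N (Ω * (E - 1))) := by
  rw [majSum, Finset.sum_range_succ', majInt, majInt, ← Finset.sum_add_distrib, Finset.mul_sum]
  have h0 : coeff 0 v = 0 := by
    rw [coeff_zero_eq_constantCoeff_apply]; exact X_dvd_iff.mp h.X_dvd
  rw [h0, norm_zero, zero_mul, add_zero]
  refine Finset.sum_le_sum fun n _ => ?_
  have h2 : ‖(n + 1 : ℂ)‖ = n + 1 := by exact_mod_cast Complex.norm_natCast (n + 1)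
  rw [h.succ_mul_coeff, norm_div, h2]
  calc _ ≤ (‖coeff n Ω‖ + ‖coeff n (Ω * (E - 1))‖) / (n + 1) * (1 / 3) ^ (n + 1) := by
        gcongr; exact norm_add_le _ _
    _ = _ := by ring

theorem majSum_succ_sub_le (h : IsComparison γ Ω v G E) :
    majSum (1 / 3) (N + 1) (X * Ω - v) ≤
      1 / 3 * (∑ n ∈ Finset.range N, ‖coeff n Ω‖ * (n / (n + 1)) * (1 / 3 : ℝ) ^ n +
        majInt (1 / 3) N (Ω * (E - 1))) := by
  rw [majSum, Finset.sum_range_succ', majInt, ← Finset.sum_add_distrib, Finset.mul_sum]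
  have h0 : coeff 0 (X * Ω - v) = 0 := by
    rw [coeff_zero_eq_constantCoeff_apply, map_sub, X_dvd_iff.mp h.X_dvd]; simp
  rw [h0, norm_zero, zero_mul, add_zero]
  refine Finset.sum_le_sum fun n _ => ?_
  have h2 : ‖(n + 1 : ℂ)‖ = n + 1 := by exact_mod_cast Complex.norm_natCast (n + 1)
  have h3 : (n + 1 : ℂ) ≠ 0 := by exact_mod_cast n.succ_ne_zero
  have h4 : coeff (n + 1) (X * Ω - v) =
      coeff n Ω * (n / (n + 1)) - coeff n (Ω * (E - 1)) / (n + 1) := by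
    rw [map_sub, coeff_succ_X_mul, h.succ_mul_coeff]
    field_simp
    ring
  rw [h4]
  calc _ ≤ (‖coeff n Ω‖ * (n / (n + 1)) + ‖coeff n (Ω * (E - 1))‖ / (n + 1)) * (1 / 3) ^ (n + 1) := by
        gcongr
        refine (norm_sub_le _ _).trans ?_
        rw [norm_mul, norm_div, norm_div, h2, Complex.norm_natCast]
    _ = _ := by ring

/-- The majorant series of `v` at radius `1/3` is at most `1/3`. -/
theorem majSum_le_third (h : IsComparison γ Ω v G E) (N : ℕ) : majSum (1 / 3) N v ≤ 1 / 3 := by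
  set c := ‖coeff 0 Ω‖ with hc
  have hc0 : 0 ≤ c := norm_nonneg _
  have hc1 : c ≤ 1 := h.schur.norm_zero_le
  -- The bound on v alone does not reproduce itself; the distance to w must be carried along. The
  -- factor 1 - c reflects that c = 1 makes w linear and forces v = w, and 9/25 is a constant for
  -- which `numeric_bounds` closes.
  suffices H : majSum (1 / 3) N (X * Ω - v) ≤ 9 / 25 * (1 - c) ∧ majSum (1 / 3) N v ≤ 1 / 3 from H.2
  induction N with
  | zero => constructor <;> simp [majSum]; linarith
  | succ N ih =>
    obtain ⟨hD, hv⟩ := ih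
    have hx3 : 122 / 25 * (9 / 25 * (1 - c)) < 3 := by linarith
    have hT := h.majInt_mul_exp_sub_one_le hx3 rfl hD hv
    obtain ⟨n1, n2⟩ := numeric_bounds hc0 hc1 rfl rfl hT
    have i1 := h.schur.sum_mul_div_le N
    have i2 := h.schur.majInt_le N
    constructor
    · refine h.majSum_succ_sub_le.trans (le_trans ?_ n1)
      gcongr
    · refine h.majSum_succ_v_le.trans ?_
      linarith

end IsComparison

end

/-! ### Majorant comparison of g with f and of f with the extremal function. -/

section

variable {ψ f g w H h u : ℂ → ℂ}

theorem isSchurSeries_dslope (hu : DifferentiableOn ℂ u disk) (hm : MapsTo u disk disk)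
    (h0 : u 0 = 0) : IsSchurSeries (taylorPS (dslope u 0)) := by
  have hb : ∀ z ∈ disk, ‖dslope u 0 z‖ ≤ 1 := by
    intro z hz
    have := norm_dslope_le_div_of_mapsTo_ball (R₁ := 1) (R₂ := 1) (c := 0) hu
      (fun x hx => by rw [h0]; exact ball_subset_closedBall (hm hx)) hz
    simpa using this
  refine ⟨?_, fun n hn => ?_⟩
  · simpa only [coeff_taylorPS, taylorCoeff_zero] using hb 0 zero_mem_disk
  · simp only [coeff_taylorPS, taylorCoeff_zero]
    exact norm_taylorCoeff_le_one_sub_sq (differentiableOn_dslope_zero hu) hb hn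

theorem taylorPS_eq_X_mul (hu : AnalyticAt ℂ u 0) (h0 : u 0 = 0) :
    taylorPS u = X * taylorPS (dslope u 0) := by
  rw [taylorPS_eq_add_X_mul hu, h0, map_zero, zero_add]

/-- Without a constant term, r^n ≤ 3r · 3⁻ⁿ for every index that matters, so the bound at 1/3 scales
down linearly. -/
theorem majSum_le_of_X_dvd {P : PowerSeries ℂ} (hP : X ∣ P) {N : ℕ} {r : ℝ} (hr0 : 0 ≤ r)
    (hr : r ≤ 1 / 3) (h : majSum (1 / 3) N P ≤ 1 / 3) : majSum r N P ≤ r := by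
  have h1 : majSum r N P ≤ 3 * r * majSum (1 / 3) N P := by
    rw [majSum, majSum, Finset.mul_sum]
    refine Finset.sum_le_sum fun n _ => ?_
    cases n with
    | zero =>
      have : coeff 0 P = 0 := by rw [coeff_zero_eq_constantCoeff_apply]; exact X_dvd_iff.mp hP
      simp [this]
    | succ n =>
      have e : 3 * r * (‖coeff (n + 1) P‖ * (1 / 3) ^ (n + 1)) =
          ‖coeff (n + 1) P‖ * (r * (1 / 3) ^ n) := by ring
      rw [e, pow_succ']
      gcongr
  nlinarith

theorem majSum_schwarz_le (hu : DifferentiableOn ℂ u disk) (hm : MapsTo u disk disk)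
    (h0 : u 0 = 0) {N : ℕ} {r : ℝ} (hr0 : 0 ≤ r) (hr : r ≤ 1 / 3) :
    majSum r N (taylorPS u) ≤ r := by
  refine majSum_le_of_X_dvd (X_dvd_taylorPS h0) hr0 hr ?_
  refine (majSum_mono (by norm_num) (Nat.le_succ N) _).trans ?_
  rw [taylorPS_eq_X_mul (analyticAt_zero hu) h0, majSum_X_mul]
  linarith [(isSchurSeries_dslope hu hm h0).majSum_le_one N]

/-- Subordination does not increase the majorant series at radii up to `1/3`. -/
theorem Subordinate.majSum_le (hf : DifferentiableOn ℂ f disk) (hg : Subordinate g f) {N : ℕ}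
    {r : ℝ}
    (hr0 : 0 ≤ r) (hr : r ≤ 1 / 3) : majSum r N (taylorPS g) ≤ majSum r N (taylorPS f) := by
  obtain ⟨u, hu, hm, h0, he⟩ := hg
  have h1 : taylorPS g = taylorPS (fun z => f (u z)) := taylorPS_congr (by
    filter_upwards [isOpen_disk.mem_nhds zero_mem_disk] with z hz using he z hz)
  rw [h1]
  refine (majSum_comp_le hr0 (analyticAt_zero hf) (analyticAt_zero hu) h0).trans ?_
  refine Finset.sum_le_sum fun n _ => ?_
  rw [coeff_taylorPS]
  have := majSum_nonneg hr0 (N := N) (taylorPS u)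
  gcongr
  exact majSum_schwarz_le hu hm h0 hr0 hr

theorem taylorCoeff_exp (n : ℕ) : taylorCoeff Complex.exp n = 1 / n.factorial := by
  simp [taylorCoeff, iteratedDeriv_eq_iterate, Complex.iter_deriv_exp]

/-- There is a germ `v` with `f(z) / z = (f₀ / id) (v(z))`, and its majorant series is bounded like
that of a Schwarz function. -/
theorem exists_comparison_germ (hψ : IsMaMinda ψ) (hh : IsExtremalLog ψ h) (hf : IsLogRep ψ f w H) :
    ∃ v : ℂ → ℂ, AnalyticAt ℂ v 0 ∧ v 0 = 0 ∧ (∀ᶠ z in 𝓝 0, H z = h (v z)) ∧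
      ∀ N, majSum (1 / 3) N (taylorPS v) ≤ 1 / 3 := by
  have hd0 : deriv ψ 0 ≠ 0 := fun h => by simpa [h] using hψ.deriv_re_pos
  have hha := analyticAt_zero hh.rep.log_diff
  have hHa := analyticAt_zero hf.log_diff
  have hwa := analyticAt_zero hf.schwarz_diff
  have hdh : deriv h 0 = deriv ψ 0 := by rw [(hh.hasDerivAt 0 zero_mem_disk).deriv, dslope_same]
  have hdh0 : deriv h 0 ≠ 0 := hdh ▸ hd0
  have hs := hha.hasStrictDerivAt
  -- h'(0) = ψ'(0) ≠ 0, so h is invertible near 0 and v = h⁻¹ ∘ H exists as a germ. No extension of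
  -- v to the disk is used.
  set η := hs.localInverse h (deriv h 0) 0 hdh0
  have hη : AnalyticAt ℂ η 0 := by
    have := hha.analyticAt_localInverse hdh0
    rwa [hh.rep.log_zero] at this
  have hη0 : η 0 = 0 := by
    have := (hs.eventually_left_inverse hdh0).self_of_nhds
    rwa [hh.rep.log_zero] at this
  have hηr : ∀ᶠ x in 𝓝 0, h (η x) = x := by
    have := hs.eventually_right_inverse hdh0
    rwa [hh.rep.log_zero] at this
  set v : ℂ → ℂ := fun z => η (H z) with hv
  have hva : AnalyticAt ℂ v 0 := AnalyticAt.fun_comp (by rwa [hf.log_zero]) hHa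
  have hv0 : v 0 = 0 := by simp [hv, hf.log_zero, hη0]
  have hHc : Tendsto H (𝓝 0) (𝓝 0) := by
    have := hHa.continuousAt.tendsto
    rwa [hf.log_zero] at this
  have hvc : Tendsto v (𝓝 0) (𝓝 0) := by
    have := hva.continuousAt.tendsto
    rwa [hv0] at this
  have hHv : ∀ᶠ z in 𝓝 0, H z = h (v z) := (hHc.eventually hηr).mono fun z hz => hz.symm
  refine ⟨v, hva, hv0, hHv, ?_⟩
  obtain ⟨Λ, hΛ, hΛe, -, hΛ2, hΛ3⟩ := hψ.exists_log_slope
  have hΛa := analyticAt_zero hΛ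
  have hΛw : AnalyticAt ℂ (fun z => Λ (w z)) 0 := AnalyticAt.fun_comp (by rwa [hf.schwarz_zero]) hwa
  have hΛv : AnalyticAt ℂ (fun z => Λ (v z)) 0 := AnalyticAt.fun_comp (by rwa [hv0]) hva
  have hGa : AnalyticAt ℂ (fun z => Λ (w z) - Λ (v z)) 0 := hΛw.fun_sub hΛv
  have hG0 : Λ (w 0) - Λ (v 0) = 0 := by rw [hf.schwarz_zero, hv0, sub_self]
  have hEa : AnalyticAt ℂ (fun z => Complex.exp (Λ (w z) - Λ (v z))) 0 := hGa.cexp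
  have hwX := taylorPS_eq_X_mul hwa hf.schwarz_zero
  -- the differential equation of `v`
  have hode : (fun z => z * deriv v z) =ᶠ[𝓝 0] fun z => w z * Complex.exp (Λ (w z) - Λ (v z)) := by
    filter_upwards [hHv.eventually_nhds, isOpen_disk.mem_nhds zero_mem_disk,
      hvc.eventually (isOpen_disk.mem_nhds zero_mem_disk), hva.eventually_analyticAt]
      with z hz hzd hvd hvz
    have h1 : HasDerivAt (fun z => h (v z)) (dslope ψ 0 (v z) * deriv v z) z :=
      (hh.hasDerivAt _ hvd).comp z hvz.differentiableAt.hasDerivAt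
    have h2 : deriv H z = dslope ψ 0 (v z) * deriv v z := by
      rw [Filter.EventuallyEq.deriv_eq hz]; exact h1.deriv
    have h3 := hf.log_deriv z hzd
    rw [h2, self_eq_add_mul_dslope ψ (w z), hψ.map_zero, hΛe _ hvd, hΛe _ (hf.schwarz_maps hzd)] at h3
    have h4 : deriv ψ 0 * (z * deriv v z * Complex.exp (Λ (v z))) =
        deriv ψ 0 * (w z * Complex.exp (Λ (w z))) := by linear_combination h3
    have h5 := mul_left_cancel₀ hd0 h4
    rw [Complex.exp_sub, ← mul_div_assoc, eq_div_iff (Complex.exp_ne_zero _)]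
    exact h5
  have hcomp : IsComparison (taylorCoeff Λ) (taylorPS (dslope w 0)) (taylorPS v)
      (taylorPS fun z => Λ (w z) - Λ (v z))
      (taylorPS fun z => Complex.exp (Λ (w z) - Λ (v z))) := by
    refine ⟨isSchurSeries_dslope hf.schwarz_diff hf.schwarz_maps hf.schwarz_zero,
      X_dvd_taylorPS hv0, ?_, ?_, ?_, hΛ2, hΛ3⟩
    · intro n
      rw [← hwX, ← taylorPS_mul hwa hEa, ← taylorPS_congr hode,
        taylorPS_mul (f := fun z => z) analyticAt_id hva.deriv, taylorPS_id]
      cases n with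
      | zero => simp
      | succ n => rw [coeff_succ_X_mul, coeff_taylorPS, coeff_taylorPS, taylorCoeff_deriv]; simp
    · intro K
      have := X_pow_dvd_taylorPS_comp hGa hG0 K (f := Complex.exp) (by fun_prop)
      simpa only [taylorCoeff_exp] using this
    · intro K
      have h1 := X_pow_dvd_taylorPS_comp hwa hf.schwarz_zero K hΛa
      have h2 := X_pow_dvd_taylorPS_comp hva hv0 K hΛa
      have h3 := dvd_sub h1 h2
      rw [← hwX, taylorPS_sub hΛw hΛv]
      convert! h3 using 1
      simp only [mul_sub, Finset.sum_sub_distrib]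
      ring
  exact hcomp.majSum_le_third

theorem IsLogRep.taylorPS_eq {w H : ℂ → ℂ} (hrep : IsLogRep ψ f w H) :
    taylorPS f = X * taylorPS (fun z => Complex.exp (H z)) := by
  have hE : AnalyticAt ℂ (fun z => Complex.exp (H z)) 0 := (analyticAt_zero hrep.log_diff).cexp
  rw [← taylorPS_id, ← taylorPS_mul (f := fun z => z) analyticAt_id hE]
  refine taylorPS_congr ?_
  filter_upwards [isOpen_disk.mem_nhds zero_mem_disk] with z hz using hrep.eq_mul_exp z hz

/-- At radii up to `1/3` the extremal function has the largest majorant series in the class. -/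
theorem majSum_le_majSum_extremal (hψ : IsMaMinda ψ) (hf : f ∈ starClass ψ) {N : ℕ} {r : ℝ}
    (hr0 : 0 ≤ r) (hr : r ≤ 1 / 3) :
    majSum r N (taylorPS f) ≤ majSum r N (taylorPS (extremal ψ)) := by
  obtain ⟨h, hh⟩ := exists_isExtremalLog hψ
  obtain ⟨w, H, hrep⟩ := exists_isLogRep hψ hf
  obtain ⟨v, hva, hv0, hHv, hmaj⟩ := exists_comparison_germ hψ hh hrep
  cases N with
  | zero => simp [majSum]
  | succ N =>
    rw [hrep.taylorPS_eq, hh.rep.taylorPS_eq, majSum_X_mul, majSum_X_mul]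
    refine mul_le_mul_of_nonneg_left ?_ hr0
    have h1 : taylorPS (fun z => Complex.exp (H z)) = taylorPS (fun z => Complex.exp (h (v z))) :=
      taylorPS_congr (hHv.mono fun z hz => by simp only [hz])
    rw [h1]
    refine (majSum_comp_le (f := fun z => Complex.exp (h z)) hr0
      (analyticAt_zero hh.rep.log_diff).cexp hva hv0).trans ?_
    refine Finset.sum_le_sum fun n _ => ?_
    rw [coeff_taylorPS]
    have := majSum_nonneg hr0 (N := N) (taylorPS v)
    gcongr
    exact majSum_le_of_X_dvd (X_dvd_taylorPS hv0) hr0 hr (hmaj N)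

end

/-! ### The root of f̂₀(r) = r_* and the Bohr inequality. -/

section

theorem summable_norm_taylorCoeff {f : ℂ → ℂ} (hf : DifferentiableOn ℂ f disk) {r : ℝ}
    (hr : r ∈ Ico (0 : ℝ) 1) : Summable fun n => ‖taylorCoeff f n‖ * r ^ n := by
  have hm : (r : ℂ) ∈ ball (0 : ℂ) 1 := by
    simpa [abs_of_nonneg hr.1] using hr.2
  refine (hasSum_taylorCoeff hf hm).summable.norm.congr fun n => ?_
  rw [norm_mul, norm_pow, Complex.norm_real, Real.norm_of_nonneg hr.1]

/-- The majorant series `∑ |a_n| r^n` of `f = ∑ a_n z^n`. -/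
noncomputable def majorant (f : ℂ → ℂ) (r : ℝ) : ℝ := ∑' n, ‖taylorCoeff f n‖ * r ^ n

theorem hasSum_majorant {f : ℂ → ℂ} (hf : DifferentiableOn ℂ f disk) {r : ℝ}
    (hr : r ∈ Ico (0 : ℝ) 1) : HasSum (fun n => ‖taylorCoeff f n‖ * r ^ n) (majorant f r) :=
  (summable_norm_taylorCoeff hf hr).hasSum

theorem continuousOn_majorant {f : ℂ → ℂ} (hf : DifferentiableOn ℂ f disk) {b : ℝ}
    (hb : b ∈ Ico (0 : ℝ) 1) : ContinuousOn (majorant f) (Icc 0 b) := by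
  refine continuousOn_tsum (fun n => by fun_prop) (summable_norm_taylorCoeff hf hb) ?_
  intro n x hx
  rw [Real.norm_of_nonneg (mul_nonneg (norm_nonneg _) (pow_nonneg hx.1 _))]
  exact mul_le_mul_of_nonneg_left (pow_le_pow_left₀ hx.1 hx.2 _) (norm_nonneg _)

theorem majSum_taylorPS_le_majorant {f : ℂ → ℂ} (hf : DifferentiableOn ℂ f disk) {r : ℝ}
    (hr : r ∈ Ico (0 : ℝ) 1) (N : ℕ) : majSum r N (taylorPS f) ≤ majorant f r := by
  simp only [majSum, coeff_taylorPS]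
  exact (summable_norm_taylorCoeff hf hr).sum_le_tsum _
    fun n _ => mul_nonneg (norm_nonneg _) (pow_nonneg hr.1 _)

/-- A majorant series with nonzero linear coefficient is strictly increasing, as far as it
converges. -/
theorem lt_of_hasSum_majorant {f : ℂ → ℂ} (h1 : deriv f 0 ≠ 0) {r s a b : ℝ} (hr : 0 ≤ r)
    (hrs : r < s) (ha : HasSum (fun n => ‖taylorCoeff f n‖ * r ^ n) a)
    (hb : HasSum (fun n => ‖taylorCoeff f n‖ * s ^ n) b) : a < b := by
  refine hasSum_lt (i := 1) (fun n => ?_) ?_ ha hb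
  · exact mul_le_mul_of_nonneg_left (pow_le_pow_left₀ hr hrs.le _) (norm_nonneg _)
  · rw [taylorCoeff_one, pow_one, pow_one]
    exact mul_lt_mul_of_pos_left hrs (norm_pos_iff.mpr h1)

theorem hasSum_majorant_succ {f : ℂ → ℂ} (h0 : f 0 = 0) {r a : ℝ} :
    HasSum (fun n => ‖taylorCoeff f (n + 1)‖ * r ^ (n + 1)) a ↔
      HasSum (fun n => ‖taylorCoeff f n‖ * r ^ n) a := by
  have := hasSum_nat_add_iff (f := fun n => ‖taylorCoeff f n‖ * r ^ n) (g := a) 1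
  simpa [h0] using this

variable {ψ h : ℂ → ℂ}

theorem taylorCoeff_extremal_two (hh : IsExtremalLog ψ h) :
    taylorCoeff (extremal ψ) 2 = deriv ψ 0 := by
  rw [← coeff_taylorPS, hh.rep.taylorPS_eq, coeff_succ_X_mul, coeff_taylorPS, taylorCoeff_one]
  have := (hh.hasDerivAt 0 zero_mem_disk).cexp
  rw [hh.rep.log_zero, Complex.exp_zero, one_mul, dslope_same] at this
  exact this.deriv

/-- In the expansion of -f₀(-r) the quadratic coefficient t₂ = ψ'(0) > 0 enters with a minus sign,
so the majorant exceeds `radialMod` by at least ψ'(0) r². -/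
theorem radialMod_add_le_majorant (hψ : IsMaMinda ψ) (hh : IsExtremalLog ψ h) {r : ℝ}
    (hr : r ∈ Ico (0 : ℝ) 1) :
    radialMod h r + (deriv ψ 0).re * r ^ 2 ≤ majorant (extremal ψ) r := by
  have hm : -(r : ℂ) ∈ ball (0 : ℂ) 1 := by
    simpa [abs_of_nonneg hr.1] using hr.2
  have hs := Complex.hasSum_re (hasSum_taylorCoeff hh.rep.differentiableOn hm).neg
  rw [extremal_neg_ofReal hψ hh ⟨by linarith [hr.1], hr.2⟩, neg_neg, Complex.ofReal_re] at hs
  have hd := (hasSum_majorant hh.rep.differentiableOn hr).sub hs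
  have hterm : ∀ n, (-(taylorCoeff (extremal ψ) n * (-(r : ℂ)) ^ n)).re ≤
      ‖taylorCoeff (extremal ψ) n‖ * r ^ n := by
    intro n
    refine (Complex.re_le_norm _).trans_eq ?_
    rw [norm_neg, norm_mul, norm_pow, norm_neg, Complex.norm_real, Real.norm_of_nonneg hr.1]
  have h2 := le_hasSum hd 2 fun n _ => sub_nonneg.mpr (hterm n)
  have h3 : (-(taylorCoeff (extremal ψ) 2 * (-(r : ℂ)) ^ 2)).re ≤ 0 := by
    rw [taylorCoeff_extremal_two hh, neg_sq, ← Complex.ofReal_pow, Complex.neg_re,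
      Complex.re_mul_ofReal]
    have := mul_nonneg hψ.deriv_re_pos.le (sq_nonneg r)
    linarith
  have h4 : (deriv ψ 0).re * r ^ 2 ≤ ‖taylorCoeff (extremal ψ) 2‖ * r ^ 2 := by
    rw [taylorCoeff_extremal_two hh]
    exact mul_le_mul_of_nonneg_right (Complex.re_le_norm _) (sq_nonneg r)
  linarith

theorem exists_radialSup_lt_majorant (hψ : IsMaMinda ψ) (hh : IsExtremalLog ψ h) :
    ∃ b ∈ Ico (0 : ℝ) 1, radialSup h < majorant (extremal ψ) b := by
  have hc := hψ.deriv_re_pos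
  -- A loss of ψ'(0)/4 is affordable, since the surplus ψ'(0) b² is at least that for b ≥ 1/2.
  obtain ⟨r, hr, hlt⟩ := exists_lt_radialMod (h := h) (y := radialSup h - (deriv ψ 0).re / 4)
    (by linarith)
  have hb : max r (1 / 2) ∈ Ico (0 : ℝ) 1 :=
    ⟨le_max_of_le_left hr.1, max_lt hr.2 (by norm_num)⟩
  refine ⟨_, hb, ?_⟩
  have h1 := radialMod_add_le_majorant hψ hh hb
  have h2 : radialMod h r ≤ radialMod h (max r (1 / 2)) :=
    (strictMonoOn_radialMod hψ hh).monotoneOn hr hb (le_max_left _ _)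
  have h3 : (1 / 2 : ℝ) ≤ max r (1 / 2) := le_max_right _ _
  have h4 : (1 / 4 : ℝ) ≤ max r (1 / 2) ^ 2 := by nlinarith
  nlinarith

theorem exists_majorant_eq_koebeRadius (hψ : IsMaMinda ψ) :
    ∃ r ∈ Ioo (0 : ℝ) 1, majorant (extremal ψ) r = koebeRadius ψ := by
  obtain ⟨h, hh⟩ := exists_isExtremalLog hψ
  obtain ⟨b, hb, hlt⟩ := exists_radialSup_lt_majorant hψ hh
  have h0 : majorant (extremal ψ) 0 = 0 := by
    rw [majorant, tsum_eq_single 0 fun n hn => by simp [hn]]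
    simp [hh.rep.map_zero]
  rw [koebeRadius_eq hψ hh]
  have hpos := radialSup_pos hψ hh
  obtain ⟨r, hr, hrs⟩ := intermediate_value_Ioo hb.1
    (continuousOn_majorant hh.rep.differentiableOn hb) ⟨by rwa [h0], hlt⟩
  exact ⟨r, ⟨hr.1, hr.2.trans hb.2⟩, hrs⟩

theorem bohrPhenomenon_of_majorant_le (hψ : IsMaMinda ψ) {R : ℝ} (hR : R ≤ 1 / 3)
    (hmaj : ∀ r, 0 ≤ r → r ≤ R → majorant (extremal ψ) r ≤ koebeRadius ψ) {f : ℂ → ℂ}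
    (hf : f ∈ starClass ψ) : BohrPhenomenon f R := by
  obtain ⟨h, hh⟩ := exists_isExtremalLog hψ
  obtain ⟨w, H, hrep⟩ := exists_isLogRep hψ hf
  intro g hg r hr0 hr
  have hr3 := hr.trans hR
  have hbound : ∀ N, ∑ k ∈ Finset.range N, ‖taylorCoeff g (k + 1)‖ * r ^ (k + 1) ≤
      boundaryDist f := by
    intro N
    calc ∑ k ∈ Finset.range N, ‖taylorCoeff g (k + 1)‖ * r ^ (k + 1)
        ≤ majSum r (N + 1) (taylorPS g) := by
          simp only [majSum, coeff_taylorPS, Finset.sum_range_succ' _ N]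
          exact le_add_of_nonneg_right (by positivity)
      _ ≤ majSum r (N + 1) (taylorPS f) := hg.majSum_le hrep.differentiableOn hr0 hr3
      _ ≤ majSum r (N + 1) (taylorPS (extremal ψ)) := majSum_le_majSum_extremal hψ hf hr0 hr3
      _ ≤ majorant (extremal ψ) r :=
          majSum_taylorPS_le_majorant hh.rep.differentiableOn ⟨hr0, by linarith⟩ _
      _ ≤ koebeRadius ψ := hmaj r hr0 hr
      _ = radialSup h := koebeRadius_eq hψ hh
      _ ≤ boundaryDist f := radialSup_le_boundaryDist hψ hh hrep
  have hnn : ∀ k, 0 ≤ ‖taylorCoeff g (k + 1)‖ * r ^ (k + 1) := fun k => by positivity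
  exact ⟨summable_of_sum_range_le hnn hbound, Real.tsum_le_of_sum_range_le hnn hbound⟩

theorem Subordinate.refl (f : ℂ → ℂ) : Subordinate f f :=
  ⟨fun z => z, differentiableOn_id, fun _ hz => hz, rfl, fun _ _ => rfl⟩

end

end MaMinda

theorem mainTheorem1 (ψ : ℂ → ℂ) (hψ : MaMinda.IsMaMinda ψ) :
    ∃ r₀ : ℝ, IsLeast (MaMinda.majorantRoots ψ) r₀ ∧
      (∀ f ∈ MaMinda.starClass ψ, MaMinda.BohrPhenomenon f (min r₀ (1 / 3))) ∧
      (min r₀ (1 / 3) = r₀ →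
        (∀ n : ℕ, 2 ≤ n → 0 < (MaMinda.taylorCoeff (MaMinda.extremal ψ) n).re ∧
          (MaMinda.taylorCoeff (MaMinda.extremal ψ) n).im = 0) →
        MaMinda.extremal ψ ∈ MaMinda.starClass ψ ∧
          MaMinda.Subordinate (MaMinda.extremal ψ) (MaMinda.extremal ψ) ∧
          HasSum (fun k : ℕ => ‖MaMinda.taylorCoeff (MaMinda.extremal ψ) (k + 1)‖ * r₀ ^ (k + 1))
            (MaMinda.boundaryDist (MaMinda.extremal ψ)) ∧
          (∀ r : ℝ, r₀ < r → r < 1 →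
            MaMinda.boundaryDist (MaMinda.extremal ψ) <
              ∑' k : ℕ, ‖MaMinda.taylorCoeff (MaMinda.extremal ψ) (k + 1)‖ * r ^ (k + 1)) ∧
          ∀ R : ℝ, r₀ < R → ¬ MaMinda.BohrPhenomenon (MaMinda.extremal ψ) R) := by
  open MaMinda in
  obtain ⟨h, hh⟩ := exists_isExtremalLog hψ
  have hmem := hh.rep.mem_starClass hψ
  have hdiff := hh.rep.differentiableOn
  have h0 : extremal ψ 0 = 0 := hh.rep.map_zero
  have h1 : deriv (extremal ψ) 0 ≠ 0 := by rw [hmem.1.deriv_zero]; exact one_ne_zero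
  obtain ⟨r₀, hr₀, hroot⟩ := exists_majorant_eq_koebeRadius hψ
  have hsum₀ := hasSum_majorant hdiff ⟨hr₀.1.le, hr₀.2⟩
  rw [hroot] at hsum₀
  have hdist : boundaryDist (extremal ψ) = koebeRadius ψ := by
    rw [boundaryDist_extremal hψ hh, koebeRadius_eq hψ hh]
  have hstrict : ∀ r : ℝ, r₀ < r → r < 1 → boundaryDist (extremal ψ) <
      ∑' k : ℕ, ‖taylorCoeff (extremal ψ) (k + 1)‖ * r ^ (k + 1) := by
    intro r hr hr1
    have hsum := hasSum_majorant hdiff (r := r) ⟨(hr₀.1.trans hr).le, hr1⟩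
    rw [((hasSum_majorant_succ h0).mpr hsum).tsum_eq, hdist]
    exact lt_of_hasSum_majorant h1 hr₀.1.le hr hsum₀ hsum
  refine ⟨r₀, ⟨⟨hr₀.1, hsum₀⟩, fun r hr => ?_⟩, fun f hf => ?_, fun _ _ => ⟨hmem,
    Subordinate.refl _, ?_, hstrict, fun R hR hB => ?_⟩⟩
  · by_contra hlt
    exact (lt_of_hasSum_majorant h1 hr.1.le (not_le.mp hlt) hr.2 hsum₀).false
  · refine bohrPhenomenon_of_majorant_le hψ (min_le_right _ _) (fun r hr0 hr => ?_) hf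
    have hr' := hr.trans (min_le_left _ _)
    rcases hr'.eq_or_lt with rfl | hlt
    · exact hroot.le
    · exact (lt_of_hasSum_majorant h1 hr0 hlt
        (hasSum_majorant hdiff ⟨hr0, hlt.trans hr₀.2⟩) hsum₀).le
  · rw [hdist]
    exact (hasSum_majorant_succ h0).mpr hsum₀
  -- R may exceed 1, so a radius between r₀ and min(R, 1) is used to keep the series convergent.
  · obtain ⟨r, hr, hrR⟩ := exists_between (lt_min hR hr₀.2)
    exact absurd (hB _ (Subordinate.refl _) r (hr₀.1.trans hr).le (hrR.le.trans (min_le_left _ _))).2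
      (hstrict r hr (hrR.trans_le (min_le_right _ _))).not_ge
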